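/- Notation. A convex body in $\mathbb{R}^d$ is a compact convex set with non-empty interior; $|\cdot|$ is volume, $\|\cdot\|$ the Euclidean norm, $\kappa_d=\pi^{d/2}/\Gamma(d/2+1)$ the volume of the unit ball of $\mathbb{R}^d$, and $L^*=\{x:\langle x,y\rangle\le 1\ \text{for all } y\in L\}$. The Santaló point $s(K)$ of a convex body $K$ is the unique point of $\operatorname{int}K$ at which $z\mapsto |(K-z)^*|$ attains its minimum over $z\in\operatorname{int}K$. Lemma. Let $d\ge 2$ be an integer, let $K_0\subset\mathbb{R}^d$ be a convex body, and let $$0<\varepsilon_1\le \min\Big\{\tfrac12,\ 2^{-2d-1}\,\frac{\kappa_{d-1}}{d\,\kappa_d^2}\cdot\frac{|K_0|}{(\operatorname{diam}K_0)^d}\Big\}.$$ Let $K\subset\mathbb{R}^d$ be a convex body and $a,b\in\mathbb{R}^d$ with $(1-\varepsilon_1)K_0+a\subset K\subset(1+\varepsilon_1)K_0+b$. Then $$\Big\|s(K)-s(K_0)-\frac{a+b}{2}\Big\|\le c_1(K_0)\,\varepsilon_1,\qquad c_1(K_0):=(\operatorname{diam}K_0)^{(d+1)^2}\,|K_0|^{-d-2}\cdot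 d\,\Big(\frac{d\,\kappa_d}{\kappa_{d-1}}\Big)^{d+2}.$$ If, moreover, $\varepsilon_2>0$, $c\in\operatorname{int}K$, $|K_0|\cdot|(K_0-s(K_0))^*|\le|K|\cdot|(K-s(K))^*|$, and $$|K|\cdot|(K-c)^*|\le|K_0|\cdot|(K_0-s(K_0))^*|+\varepsilon_2\le\kappa_d^2,$$ then $$\Big\|c-s(K_0)-\frac{a+b}{2}\Big\|\le c_1(K_0)\,\varepsilon_1+c_2(K_0)\sqrt{\varepsilon_2},\qquad c_2(K_0):=\sqrt{\frac{(\operatorname{diam}K_0)^{d+2}}{|K_0|}}\cdot\sqrt{\frac{2^{d+3}}{(d+1)\,\kappa_d}}.$$ (In particular, for $a=b=0$ the left-hand sides are $\|s(K)-s(K_0)\|$ and $\|c-s(K_0)\|$.) -/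

import Mathlib

open MeasureTheory
open scoped Pointwise

noncomputable section

/-- A convex body: a compact convex set with non-empty interior. (Mathlib's `ConvexBody` does not
require non-empty interior.) -/
structure IsSolidConvexBody {d : ℕ} (K : Set (EuclideanSpace ℝ (Fin d))) : Prop where
  isCompact : IsCompact K
  convex : Convex ℝ K
  interior_nonempty : (interior K).Nonempty

/-- The (one-sided) polar `K* = {x : ⟨x, y⟩ ≤ 1 for all y ∈ K}`. -/
def convexPolar {d : ℕ} (K : Set (EuclideanSpace ℝ (Fin d))) : Set (EuclideanSpace ℝ (Fin d)) :=
  {x | ∀ y ∈ K, inner ℝ x y ≤ 1}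

/-- `s` is an interior point of `K` minimizing `z ↦ |(K - z)*|` over the interior of `K`.
For a convex body `K` and `z` in its interior, `(K - z)*` is bounded, so all volumes compared
here are finite. -/
def IsSantaloPoint {d : ℕ} (K : Set (EuclideanSpace ℝ (Fin d)))
    (s : EuclideanSpace ℝ (Fin d)) : Prop :=
  s ∈ interior K ∧
    ∀ z ∈ interior K, volume.real (convexPolar (K - {s})) ≤ volume.real (convexPolar (K - {z}))

/-- The Santaló point `s(K)`: the point satisfying `IsSantaloPoint K` (for a convex body there is
exactly one such point). -/
def santaloPoint {d : ℕ} (K : Set (EuclideanSpace ℝ (Fin d))) : EuclideanSpace ℝ (Fin d) :=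
  Classical.epsilon (IsSantaloPoint K)

/-- `|K| · |(K - z)*|`, the volume product of `K` with centre of polarity `z`. -/
def volumeProductAt {d : ℕ} (K : Set (EuclideanSpace ℝ (Fin d)))
    (z : EuclideanSpace ℝ (Fin d)) : ℝ :=
  volume.real K * volume.real (convexPolar (K - {z}))

/-- `κ_d = π^{d/2} / Γ(d/2 + 1)`, the volume of the Euclidean unit ball of dimension `d`. -/
def unitBallVolume (d : ℕ) : ℝ :=
  Real.pi ^ ((d : ℝ) / 2) / Real.Gamma ((d : ℝ) / 2 + 1)

/-- `min {1/2, 2^{-2d-1} (κ_{d-1} / (d κ_d²)) |K₀| / (diam K₀)^d}`; used for `d ≥ 2`. -/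
def epsOneBound {d : ℕ} (K₀ : Set (EuclideanSpace ℝ (Fin d))) : ℝ :=
  min (1 / 2)
    (((2 : ℝ) ^ (2 * d + 1))⁻¹ * (unitBallVolume (d - 1) / ((d : ℝ) * unitBallVolume d ^ 2)) *
      volume.real K₀ / Metric.diam K₀ ^ d)

/-- `(diam K₀)^{(d+1)²} |K₀|^{-d-2} · d · (d κ_d / κ_{d-1})^{d+2}`; used for `d ≥ 2`. -/
def centreConstOne {d : ℕ} (K₀ : Set (EuclideanSpace ℝ (Fin d))) : ℝ :=
  Metric.diam K₀ ^ ((d + 1) ^ 2) * (volume.real K₀ ^ (d + 2))⁻¹ *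
    ((d : ℝ) * ((d : ℝ) * unitBallVolume d / unitBallVolume (d - 1)) ^ (d + 2))

/-- `√((diam K₀)^{d+2} / |K₀|) · √(2^{d+3} / ((d+1) κ_d))`. -/
def centreConstTwo {d : ℕ} (K₀ : Set (EuclideanSpace ℝ (Fin d))) : ℝ :=
  Real.sqrt (Metric.diam K₀ ^ (d + 2) / volume.real K₀) *
    Real.sqrt ((2 : ℝ) ^ (d + 3) / (((d : ℝ) + 1) * unitBallVolume d))

end

open Set Filter Topology

noncomputable section

/-- The support function `h_K(x) = sup {⟨x, y⟩ : y ∈ K}`. -/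
def supportFn {d : ℕ} (K : Set (EuclideanSpace ℝ (Fin d))) (x : EuclideanSpace ℝ (Fin d)) : ℝ :=
  sSup ((fun y => inner ℝ x y) '' K)

section SupportFn

variable {d : ℕ} {K : Set (EuclideanSpace ℝ (Fin d))}

theorem inner_le_supportFn (hK : IsCompact K) (x : EuclideanSpace ℝ (Fin d))
    {y : EuclideanSpace ℝ (Fin d)} (hy : y ∈ K) : inner ℝ x y ≤ supportFn K x :=
  le_csSup (hK.image (by fun_prop)).bddAbove (mem_image_of_mem _ hy)

theorem supportFn_le (hne : K.Nonempty) {x : EuclideanSpace ℝ (Fin d)} {c : ℝ}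
    (h : ∀ y ∈ K, inner ℝ x y ≤ c) : supportFn K x ≤ c :=
  csSup_le (hne.image _) (by rintro _ ⟨y, hy, rfl⟩; exact h y hy)

theorem exists_inner_eq_supportFn (hK : IsCompact K) (hne : K.Nonempty)
    (x : EuclideanSpace ℝ (Fin d)) : ∃ y ∈ K, inner ℝ x y = supportFn K x := by
  obtain ⟨y, hy, h⟩ := (hK.image (f := fun y => inner ℝ x y) (by fun_prop)).sSup_mem (hne.image _)
  exact ⟨y, hy, h⟩

theorem supportFn_smul (hK : IsCompact K) (hne : K.Nonempty) {t : ℝ} (ht : 0 ≤ t)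
    (x : EuclideanSpace ℝ (Fin d)) : supportFn K (t • x) = t * supportFn K x := by
  apply le_antisymm
  · refine supportFn_le hne fun y hy => ?_
    rw [real_inner_smul_left]
    exact mul_le_mul_of_nonneg_left (inner_le_supportFn hK x hy) ht
  · obtain ⟨y, hy, h⟩ := exists_inner_eq_supportFn hK hne x
    rw [← h, ← real_inner_smul_left]
    exact inner_le_supportFn hK _ hy

theorem supportFn_add_le (hK : IsCompact K) (hne : K.Nonempty)
    (x y : EuclideanSpace ℝ (Fin d)) :
    supportFn K (x + y) ≤ supportFn K x + supportFn K y :=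
  supportFn_le hne fun z hz => by
    rw [inner_add_left]
    exact add_le_add (inner_le_supportFn hK x hz) (inner_le_supportFn hK y hz)

theorem supportFn_add_supportFn_neg_le (hK : IsCompact K) (hne : K.Nonempty)
    (x : EuclideanSpace ℝ (Fin d)) :
    supportFn K x + supportFn K (-x) ≤ Metric.diam K * ‖x‖ := by
  obtain ⟨y, hy, h⟩ := exists_inner_eq_supportFn hK hne x
  obtain ⟨z, hz, h'⟩ := exists_inner_eq_supportFn hK hne (-x)
  rw [← h, ← h', inner_neg_left, ← sub_eq_add_neg, ← inner_sub_right, mul_comm]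
  refine (real_inner_le_norm _ _).trans (mul_le_mul_of_nonneg_left ?_ (norm_nonneg _))
  rw [← dist_eq_norm]
  exact Metric.dist_le_diam_of_mem hK.isBounded hy hz

theorem supportFn_zero (hne : K.Nonempty) : supportFn K 0 = 0 := by
  simp [supportFn, hne.image_const]

theorem continuous_supportFn (hK : IsCompact K) (hne : K.Nonempty) :
    Continuous (supportFn K) := by
  obtain ⟨C, hC0, hC⟩ := hK.isBounded.exists_pos_norm_le
  refine (LipschitzWith.of_le_add_mul ⟨C, hC0.le⟩ fun x y => ?_).continuous
  calc supportFn K x = supportFn K (y + (x - y)) := by rw [add_sub_cancel]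
    _ ≤ supportFn K y + supportFn K (x - y) := supportFn_add_le hK hne _ _
    _ ≤ supportFn K y + C * dist x y := by
      gcongr
      refine supportFn_le hne fun z hz => (real_inner_le_norm _ _).trans ?_
      rw [dist_eq_norm, mul_comm]
      exact mul_le_mul_of_nonneg_right (hC z hz) (norm_nonneg _)

theorem le_supportFn_of_closedBall_subset (hK : IsCompact K) {z : EuclideanSpace ℝ (Fin d)}
    {r : ℝ} (hr : 0 ≤ r) (h : Metric.closedBall z r ⊆ K) (x : EuclideanSpace ℝ (Fin d)) :
    r * ‖x‖ ≤ supportFn K x - inner ℝ z x := by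
  rcases eq_or_ne x 0 with rfl | hx
  · have := inner_le_supportFn hK 0 (h (Metric.mem_closedBall_self hr))
    simpa using this
  have hx' : ‖x‖ ≠ 0 := norm_ne_zero_iff.2 hx
  have hm : z + (r / ‖x‖) • x ∈ K := h (by
    rw [Metric.mem_closedBall, dist_eq_norm, add_sub_cancel_left, norm_smul, Real.norm_eq_abs,
      abs_div, abs_norm, div_mul_cancel₀ _ hx', abs_of_nonneg hr])
  have := inner_le_supportFn hK x hm
  rw [inner_add_right, real_inner_smul_right, real_inner_self_eq_norm_sq, real_inner_comm] at this
  have e : r / ‖x‖ * ‖x‖ ^ 2 = r * ‖x‖ := by field_simp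
  linarith

theorem exists_le_supportFn_of_mem_interior (hK : IsCompact K) {z : EuclideanSpace ℝ (Fin d)}
    (hz : z ∈ interior K) :
    ∃ r, 0 < r ∧ ∀ x, r * ‖x‖ ≤ supportFn K x - inner ℝ z x := by
  obtain ⟨r, hr, h⟩ := Metric.nhds_basis_closedBall.mem_iff.1 (mem_interior_iff_mem_nhds.1 hz)
  exact ⟨r, hr, le_supportFn_of_closedBall_subset hK hr.le h⟩

theorem mem_convexPolar_sub_singleton_iff (hK : IsCompact K) (hne : K.Nonempty)
    (z x : EuclideanSpace ℝ (Fin d)) :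
    x ∈ convexPolar (K - {z}) ↔ supportFn K x - inner ℝ z x ≤ 1 := by
  have key : x ∈ convexPolar (K - {z}) ↔ ∀ y ∈ K, inner ℝ x (y - z) ≤ 1 := by
    simp [convexPolar, sub_singleton]
  rw [key]
  constructor
  · intro h
    rw [sub_le_iff_le_add]
    refine supportFn_le hne fun y hy => ?_
    have := h y hy
    rw [inner_sub_right, real_inner_comm z x] at this
    linarith
  · intro h y hy
    have := inner_le_supportFn hK x hy
    rw [inner_sub_right, real_inner_comm z x]
    linarith

end SupportFn

section LayerCake

variable {d : ℕ}

theorem lintegral_exp_neg_mul_pow (d : ℕ) :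
    ∫⁻ s in Ioi (0 : ℝ), ENNReal.ofReal (Real.exp (-s)) * ENNReal.ofReal (s ^ d) =
      ENNReal.ofReal (d.factorial : ℝ) := by
  have h1 : ∫ s in Ioi (0 : ℝ), Real.exp (-s) * s ^ d = (d.factorial : ℝ) := by
    rw [← Real.Gamma_nat_eq_factorial, Real.Gamma_eq_integral (by positivity)]
    refine setIntegral_congr_fun measurableSet_Ioi fun s _ => ?_
    simp [Real.rpow_natCast]
  have h2 : IntegrableOn (fun s : ℝ => Real.exp (-s) * s ^ d) (Ioi 0) := by
    have := Real.GammaIntegral_convergent (s := d + 1) (by positivity)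
    refine this.congr_fun (fun s _ => ?_) measurableSet_Ioi
    simp [Real.rpow_natCast]
  rw [← h1, ofReal_integral_eq_lintegral_ofReal h2]
  · refine setLIntegral_congr_fun measurableSet_Ioi fun s _ => ?_
    exact (ENNReal.ofReal_mul (Real.exp_nonneg _)).symm
  · refine (ae_restrict_iff' measurableSet_Ioi).2 (.of_forall fun s (hs : 0 < s) => ?_)
    dsimp; positivity

theorem lintegral_exp_neg_of_homogeneous {g : EuclideanSpace ℝ (Fin d) → ℝ} (hg : Continuous g)
    (h0 : ∀ x, 0 ≤ g x) (hs : ∀ t, 0 ≤ t → ∀ x, g (t • x) = t * g x) :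
    ∫⁻ x, ENNReal.ofReal (Real.exp (-g x)) =
      ENNReal.ofReal (d.factorial : ℝ) * volume {x | g x ≤ 1} := by
  have hexp : ∀ a : ℝ, 0 ≤ a →
      ∫⁻ s in Ioi (0 : ℝ), (Ici a).indicator (fun s => ENNReal.ofReal (Real.exp (-s))) s =
        ENNReal.ofReal (Real.exp (-a)) := by
    intro a ha
    have he : (Ici a ∩ Ioi 0 : Set ℝ) =ᵐ[volume] (Ioi a : Set ℝ) := by
      refine (Ioi_ae_eq_Ici.symm.inter (ae_eq_refl _)).trans (Filter.EventuallyEq.of_eq ?_)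
      rw [Ioi_inter_Ioi, sup_of_le_left ha]
    rw [lintegral_indicator measurableSet_Ici, Measure.restrict_restrict measurableSet_Ici,
      Measure.restrict_congr_set he, ← ofReal_integral_eq_lintegral_ofReal
      (integrableOn_exp_neg_Ioi a) (.of_forall fun _ => Real.exp_nonneg _), integral_exp_neg_Ioi]
  have hmeas : Measurable (Function.uncurry fun (x : EuclideanSpace ℝ (Fin d)) (s : ℝ) =>
      (Ici (g x)).indicator (fun s => ENNReal.ofReal (Real.exp (-s))) s) := by
    have : (Function.uncurry fun (x : EuclideanSpace ℝ (Fin d)) (s : ℝ) =>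
      (Ici (g x)).indicator (fun s => ENNReal.ofReal (Real.exp (-s))) s) =
      {p : EuclideanSpace ℝ (Fin d) × ℝ | g p.1 ≤ p.2}.indicator
        (fun p => ENNReal.ofReal (Real.exp (-p.2))) := by
      ext ⟨x, s⟩; simp [indicator]
    rw [this]
    refine Measurable.indicator (by fun_prop) ?_
    exact (isClosed_le (by fun_prop) (by fun_prop)).measurableSet
  calc ∫⁻ x, ENNReal.ofReal (Real.exp (-g x))
      = ∫⁻ x, ∫⁻ s in Ioi (0 : ℝ),
          (Ici (g x)).indicator (fun s => ENNReal.ofReal (Real.exp (-s))) s := by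
        simp_rw [hexp _ (h0 _)]
    _ = ∫⁻ s in Ioi (0 : ℝ), ∫⁻ x,
          (Ici (g x)).indicator (fun s => ENNReal.ofReal (Real.exp (-s))) s :=
        lintegral_lintegral_swap hmeas.aemeasurable
    _ = ∫⁻ s in Ioi (0 : ℝ), ENNReal.ofReal (Real.exp (-s)) * ENNReal.ofReal (s ^ d) *
          volume {x | g x ≤ 1} := by
        refine setLIntegral_congr_fun measurableSet_Ioi fun s (hs0 : 0 < s) => ?_
        have e : {x | g x ≤ s} = s • {x | g x ≤ 1} := by
          ext x
          rw [mem_smul_set_iff_inv_smul_mem₀ hs0.ne', mem_ofPred_eq, mem_ofPred_eq,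
            hs _ (inv_nonneg.2 hs0.le), inv_mul_le_iff₀ hs0, mul_one]
        have e2 : ∀ x, (Ici (g x)).indicator (fun s => ENNReal.ofReal (Real.exp (-s))) s =
            {x | g x ≤ s}.indicator (fun _ => ENNReal.ofReal (Real.exp (-s))) x := by
          intro x; simp [indicator]
        simp_rw [e2]
        rw [lintegral_indicator_const (isClosed_le hg continuous_const).measurableSet, e,
          Measure.addHaar_smul, finrank_euclideanSpace_fin, abs_of_pos (pow_pos hs0 d), mul_assoc]
    _ = _ := by
        rw [lintegral_mul_const _ (by fun_prop), lintegral_exp_neg_mul_pow]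

theorem volume_real_convexPolar {K : Set (EuclideanSpace ℝ (Fin d))} (hK : IsCompact K)
    {z : EuclideanSpace ℝ (Fin d)} (hz : z ∈ K) :
    ∫ x, Real.exp (-(supportFn K x - inner ℝ z x)) =
      d.factorial * volume.real (convexPolar (K - {z})) := by
  have hne : K.Nonempty := ⟨z, hz⟩
  have hc := continuous_supportFn hK hne
  rw [integral_eq_lintegral_of_nonneg_ae (.of_forall fun _ => Real.exp_nonneg _)
    (by fun_prop : Continuous _).aestronglyMeasurable,
    lintegral_exp_neg_of_homogeneous (by fun_prop), ENNReal.toReal_mul,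
    ENNReal.toReal_ofReal (by positivity), Measure.real]
  · congr 3
    ext x; rw [mem_convexPolar_sub_singleton_iff hK hne]; rfl
  · intro x
    have := inner_le_supportFn hK x hz
    rw [real_inner_comm] at this
    linarith
  · intro t ht x
    rw [supportFn_smul hK hne ht, real_inner_smul_right]; ring

end LayerCake

section Radial

variable {d : ℕ}

theorem unitBallVolume_pos (d : ℕ) : 0 < unitBallVolume d :=
  div_pos (Real.rpow_pos_of_pos Real.pi_pos _) (Real.Gamma_pos_of_pos (by positivity))

theorem sqrt_pi_pow_div_Gamma (d : ℕ) :
    √Real.pi ^ d / Real.Gamma ((d : ℝ) / 2 + 1) = unitBallVolume d := by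
  rw [unitBallVolume, Real.sqrt_eq_rpow, ← Real.rpow_natCast, ← Real.rpow_mul Real.pi_pos.le]
  congr 2; ring

theorem volume_ball_eq_unitBallVolume (hd : d ≠ 0) (x : EuclideanSpace ℝ (Fin d)) (r : ℝ) :
    volume (Metric.ball x r) = ENNReal.ofReal r ^ d * ENNReal.ofReal (unitBallVolume d) := by
  have : Nonempty (Fin d) := Fin.pos_iff_nonempty.1 (Nat.pos_of_ne_zero hd)
  rw [EuclideanSpace.volume_ball, Fintype.card_fin, sqrt_pi_pow_div_Gamma]

theorem integrable_norm_pow_mul_exp (hd : d ≠ 0) (k : ℕ) {r : ℝ} (hr : 0 < r) :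
    Integrable fun x : EuclideanSpace ℝ (Fin d) => ‖x‖ ^ k * Real.exp (-(r * ‖x‖)) := by
  have : Nonempty (Fin d) := Fin.pos_iff_nonempty.1 (Nat.pos_of_ne_zero hd)
  rw [integrable_fun_norm_addHaar volume (f := fun y => y ^ k * Real.exp (-(r * y))),
    finrank_euclideanSpace_fin]
  have h := integrableOn_rpow_mul_exp_neg_mul_rpow (s := ((d - 1 + k : ℕ) : ℝ)) (p := 1) (b := r)
    (lt_of_lt_of_le (by norm_num) (Nat.cast_nonneg _)) one_pos hr
  refine h.congr_fun (fun y _ => ?_) measurableSet_Ioi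
  simp only [Real.rpow_natCast, Real.rpow_one, smul_eq_mul, pow_add, neg_mul]
  ring

theorem integral_norm_pow_mul_exp (hd : d ≠ 0) (k : ℕ) {r : ℝ} (hr : 0 < r) :
    ∫ x : EuclideanSpace ℝ (Fin d), ‖x‖ ^ k * Real.exp (-(r * ‖x‖)) =
      d * unitBallVolume d * ((1 / r) ^ (d + k) * (d + k - 1).factorial) := by
  have : Nonempty (Fin d) := Fin.pos_iff_nonempty.1 (Nat.pos_of_ne_zero hd)
  obtain ⟨n, rfl⟩ := Nat.exists_eq_succ_of_ne_zero hd
  rw [integral_fun_norm_addHaar volume (f := fun y => y ^ k * Real.exp (-(r * y))),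
    finrank_euclideanSpace_fin, Measure.real, volume_ball_eq_unitBallVolume hd]
  have h := Real.integral_rpow_mul_exp_neg_mul_Ioi (a := (n + k : ℕ) + 1) (by positivity) hr
  rw [Real.Gamma_nat_eq_factorial, ← Nat.cast_succ, Real.rpow_natCast] at h
  have e : ∫ y in Ioi (0 : ℝ), y ^ (n.succ - 1) • (y ^ k * Real.exp (-(r * y))) =
      (1 / r) ^ (n + k).succ * (n + k).factorial := by
    rw [← h]
    refine setIntegral_congr_fun measurableSet_Ioi fun y _ => ?_
    simp only [Nat.succ_sub_one, smul_eq_mul, Nat.cast_succ, add_sub_cancel_right,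
      Real.rpow_natCast, pow_add]
    ring
  rw [e]
  have e1 : n.succ + k = (n + k).succ := by omega
  have e2 : n.succ + k - 1 = n + k := by omega
  rw [e1, e2] at *
  simp only [ENNReal.ofReal_one, one_pow, one_mul, nsmul_eq_mul, smul_eq_mul,
    ENNReal.toReal_ofReal (unitBallVolume_pos _).le]
  ring

theorem integrable_inner_sq_mul_exp (hd : d ≠ 0) (v : EuclideanSpace ℝ (Fin d)) {r : ℝ}
    (hr : 0 < r) :
    Integrable fun x : EuclideanSpace ℝ (Fin d) => (inner ℝ v x) ^ 2 * Real.exp (-(r * ‖x‖)) := by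
  refine ((integrable_norm_pow_mul_exp hd 2 hr).const_mul (‖v‖ ^ 2)).mono'
    (by fun_prop : Continuous _).aestronglyMeasurable (.of_forall fun x => ?_)
  rw [Real.norm_of_nonneg (by positivity), ← mul_assoc, ← mul_pow]
  gcongr ?_ * _
  exact sq_le_sq' (neg_le_of_abs_le (abs_real_inner_le_norm v x)) (real_inner_le_norm v x)

theorem integral_inner_sq_mul_exp_congr {v w : EuclideanSpace ℝ (Fin d)} (h : ‖v‖ = ‖w‖) (r : ℝ) :
    ∫ x, (inner ℝ v x) ^ 2 * Real.exp (-(r * ‖x‖)) =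
      ∫ x, (inner ℝ w x) ^ 2 * Real.exp (-(r * ‖x‖)) := by
  set f := (ℝ ∙ (v - w))ᗮ.reflection
  have hf : f v = w := Submodule.reflection_sub h
  rw [← f.measurePreserving.integral_comp f.toHomeomorph.measurableEmbedding
    (fun x => (inner ℝ w x) ^ 2 * Real.exp (-(r * ‖x‖)))]
  simp_rw [← hf, f.inner_map_map, f.norm_map]

theorem integral_inner_sq_mul_exp (hd : d ≠ 0) (v : EuclideanSpace ℝ (Fin d)) {r : ℝ}
    (hr : 0 < r) :
    ∫ x, (inner ℝ v x) ^ 2 * Real.exp (-(r * ‖x‖)) =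
      ‖v‖ ^ 2 * unitBallVolume d * ((1 / r) ^ (d + 2) * (d + 1).factorial) := by
  have h1 : ∀ i : Fin d, ∫ x, (inner ℝ v x) ^ 2 * Real.exp (-(r * ‖x‖)) =
      ‖v‖ ^ 2 * ∫ x : EuclideanSpace ℝ (Fin d), x i ^ 2 * Real.exp (-(r * ‖x‖)) := by
    intro i
    rw [integral_inner_sq_mul_exp_congr (w := ‖v‖ • EuclideanSpace.single i (1 : ℝ))
      (by simp [norm_smul]), ← integral_const_mul]
    congr 1; ext x
    rw [real_inner_smul_left, EuclideanSpace.inner_single_left]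
    simp; ring
  have h2 : ∑ i : Fin d, ∫ x : EuclideanSpace ℝ (Fin d), x i ^ 2 * Real.exp (-(r * ‖x‖)) =
      ∫ x : EuclideanSpace ℝ (Fin d), ‖x‖ ^ 2 * Real.exp (-(r * ‖x‖)) := by
    rw [← integral_finsetSum]
    · congr 1; ext x
      rw [← Finset.sum_mul, EuclideanSpace.norm_sq_eq]
      simp
    · intro i _
      have := integrable_inner_sq_mul_exp hd (EuclideanSpace.single i (1 : ℝ)) hr
      simpa [EuclideanSpace.inner_single_left] using this
  rw [integral_norm_pow_mul_exp hd 2 hr] at h2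
  have h3 : (d : ℝ) * ∫ x, (inner ℝ v x) ^ 2 * Real.exp (-(r * ‖x‖)) =
      ‖v‖ ^ 2 * (d * unitBallVolume d * ((1 / r) ^ (d + 2) * (d + 2 - 1).factorial)) := by
    rw [← h2, Finset.mul_sum, Finset.sum_congr rfl fun i _ => (h1 i).symm]
    simp
  have hd' : (d : ℝ) ≠ 0 := Nat.cast_ne_zero.2 hd
  apply mul_left_cancel₀ hd'
  rw [h3, show d + 2 - 1 = d + 1 by omega]; ring

end Radial

section Convexity

variable {d : ℕ}

theorem pow_four_div_four_le_exp_mul_exp (b : ℝ) :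
    b ^ 4 / 4 ≤ (Real.exp b - 1 - b) * (Real.exp (-b) - 1 + b) := by
  have key : ∀ b : ℝ, 0 ≤ b → b ^ 4 / 4 ≤ (Real.exp b - 1 - b) * (Real.exp (-b) - 1 + b) := by
    intro b hb
    set F : ℝ → ℝ := fun b => (Real.exp b - 1 - b) * (Real.exp (-b) - 1 + b) - b ^ 4 / 4
    have hF : ∀ x, HasDerivAt F ((Real.exp x - 1) * (Real.exp (-x) - 1 + x) +
        (Real.exp x - 1 - x) * (Real.exp (-x) * (-1) + 1) - (4 : ℕ) * x ^ (4 - 1) / 4) x :=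
      fun x => ((((Real.hasDerivAt_exp x).sub_const 1).sub (hasDerivAt_id x)).mul
        ((((hasDerivAt_neg x).exp).sub_const 1).add (hasDerivAt_id x))).sub
        ((hasDerivAt_pow 4 x).div_const 4)
    have hm : MonotoneOn F (Ici 0) := by
      refine monotoneOn_of_deriv_nonneg (convex_Ici 0)
        (fun x _ => (hF x).continuousAt.continuousWithinAt)
        (fun x _ => (hF x).differentiableAt.differentiableWithinAt) fun x hx => ?_
      rw [interior_Ici, mem_Ioi] at hx
      rw [(hF x).deriv]
      have hcosh : 1 + x ^ 2 / 2 ≤ (Real.exp x + Real.exp (-x)) / 2 := by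
        rw [← Real.cosh_eq, show x = 2 * (x / 2) by ring, Real.cosh_two_mul, Real.cosh_sq]
        have := Real.self_le_sinh_iff.2 (by linarith : 0 ≤ x / 2)
        nlinarith
      have he : Real.exp x * Real.exp (-x) = 1 := by rw [← Real.exp_add]; simp
      have : (Real.exp x - 1) * (Real.exp (-x) - 1 + x) +
          (Real.exp x - 1 - x) * (Real.exp (-x) * (-1) + 1) - (4 : ℕ) * x ^ (4 - 1) / 4 =
          2 * x * ((Real.exp x + Real.exp (-x)) / 2 - (1 + x ^ 2 / 2)) := by
        push_cast
        ring
      rw [this]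
      exact mul_nonneg (by linarith) (by linarith)
    have := hm (mem_Ici.2 le_rfl) hb hb
    simp only [F] at this
    norm_num at this
    linarith
  rcases le_total 0 b with h | h
  · exact key b h
  · have := key (-b) (by linarith)
    rw [neg_neg] at this
    linarith [show (-b) ^ 4 = b ^ 4 by ring, mul_comm (Real.exp (-b) - 1 - -b) (Real.exp b - 1 + -b)]

/-- A symmetrized second-order lower bound for the exponential. -/
theorem sq_mul_exp_le_add {A A' b W : ℝ} (h : -W ≤ A + A') :
    b ^ 2 * Real.exp (-W / 2) ≤
      Real.exp A * (Real.exp b - 1 - b) + Real.exp A' * (Real.exp (-b) - 1 + b) := by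
  set p := Real.exp b - 1 - b
  set q := Real.exp (-b) - 1 + b
  have hp : 0 ≤ p := by have := Real.add_one_le_exp b; simp only [p]; linarith
  have hq : 0 ≤ q := by have := Real.add_one_le_exp (-b); simp only [q]; linarith
  have h4 := pow_four_div_four_le_exp_mul_exp b
  refine abs_le_of_sq_le_sq' (a := b ^ 2 * Real.exp (-W / 2)) ?_ (by positivity) |>.2
  calc (b ^ 2 * Real.exp (-W / 2)) ^ 2 = b ^ 4 * Real.exp (-W) := by
        rw [mul_pow, ← Real.exp_nat_mul]; ring_nf
    _ ≤ 4 * (p * q) * Real.exp (A + A') := by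
        gcongr
        linarith
    _ = 4 * (Real.exp A * p) * (Real.exp A' * q) := by rw [Real.exp_add]; ring
    _ ≤ _ := by nlinarith [sq_nonneg (Real.exp A * p - Real.exp A' * q)]

theorem integrable_mul_exp_neg (hd : d ≠ 0) {f G : EuclideanSpace ℝ (Fin d) → ℝ}
    (hf : Continuous f) (hG : Continuous G) {C r : ℝ} {k : ℕ} (hr : 0 < r)
    (hfC : ∀ x, |f x| ≤ C * ‖x‖ ^ k) (hGr : ∀ x, r * ‖x‖ ≤ G x) :
    Integrable fun x => f x * Real.exp (-G x) := by
  refine ((integrable_norm_pow_mul_exp hd k hr).const_mul C).mono'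
    (by fun_prop : Continuous _).aestronglyMeasurable (.of_forall fun x => ?_)
  rw [Real.norm_eq_abs, abs_mul, Real.abs_exp, ← mul_assoc]
  exact mul_le_mul (hfC x) (Real.exp_le_exp.2 (neg_le_neg (hGr x))) (Real.exp_nonneg _)
    ((abs_nonneg _).trans (hfC x))

theorem integrable_exp_neg (hd : d ≠ 0) {G : EuclideanSpace ℝ (Fin d) → ℝ}
    (hG : Continuous G) {r : ℝ} (hr : 0 < r) (hGr : ∀ x, r * ‖x‖ ≤ G x) :
    Integrable fun x => Real.exp (-G x) := by
  simpa using integrable_mul_exp_neg hd (f := fun _ => 1) (C := 1) (k := 0) continuous_const hG hr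
    (by simp) hGr

theorem integrable_inner_mul_exp_neg (hd : d ≠ 0) (v : EuclideanSpace ℝ (Fin d))
    {G : EuclideanSpace ℝ (Fin d) → ℝ}
    (hG : Continuous G) {r : ℝ} (hr : 0 < r) (hGr : ∀ x, r * ‖x‖ ≤ G x) :
    Integrable fun x => inner ℝ v x * Real.exp (-G x) :=
  integrable_mul_exp_neg hd (C := ‖v‖) (k := 1) (by fun_prop) hG hr
    (by simpa using abs_real_inner_le_norm v) hGr

theorem add_sq_le_integral_exp (hd : d ≠ 0) {h : EuclideanSpace ℝ (Fin d) → ℝ}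
    (hh : Continuous h) {W r : ℝ} (hW : 0 < W) (hr : 0 < r)
    (hsym : ∀ x, h x + h (-x) ≤ W * ‖x‖) {z c : EuclideanSpace ℝ (Fin d)}
    (hz : ∀ x, r * ‖x‖ ≤ h x - inner ℝ z x) (hc : ∀ x, r * ‖x‖ ≤ h x - inner ℝ c x) :
    (∫ x, Real.exp (-(h x - inner ℝ z x))) +
      (∫ x, inner ℝ (c - z) x * Real.exp (-(h x - inner ℝ z x))) +
      1 / 2 * (‖c - z‖ ^ 2 * unitBallVolume d * ((2 / W) ^ (d + 2) * (d + 1).factorial)) ≤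
      ∫ x, Real.exp (-(h x - inner ℝ c x)) := by
  have iz := integrable_exp_neg hd (by fun_prop) hr hz
  have ic := integrable_exp_neg hd (by fun_prop) hr hc
  have iv := integrable_inner_mul_exp_neg hd (c - z) (by fun_prop) hr hz
  set J : EuclideanSpace ℝ (Fin d) → ℝ := fun x =>
    Real.exp (-(h x - inner ℝ c x)) - Real.exp (-(h x - inner ℝ z x)) -
      inner ℝ (c - z) x * Real.exp (-(h x - inner ℝ z x))
  have iJ : Integrable J := (ic.sub iz).sub iv
  have hJi : ∫ x, J x = (∫ x, Real.exp (-(h x - inner ℝ c x))) -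
      (∫ x, Real.exp (-(h x - inner ℝ z x))) -
      ∫ x, inner ℝ (c - z) x * Real.exp (-(h x - inner ℝ z x)) := by
    exact (integral_sub (ic.sub iz) iv).trans (congrArg (· - _) (integral_sub ic iz))
  have hJexp : ∀ x, J x = Real.exp (-(h x - inner ℝ z x)) *
      (Real.exp (inner ℝ (c - z) x) - 1 - inner ℝ (c - z) x) := by
    intro x
    have : -(h x - inner ℝ c x) = -(h x - inner ℝ z x) + inner ℝ (c - z) x := by
      rw [inner_sub_left]; ring
    simp only [J]
    rw [this, Real.exp_add]; ring
  have hle : ∫ x, (inner ℝ (c - z) x) ^ 2 * Real.exp (-(W / 2 * ‖x‖)) ≤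
      ∫ x, (J x + J (-x)) := by
    refine integral_mono (integrable_inner_sq_mul_exp hd _ (by positivity))
      (iJ.add iJ.comp_neg) fun x => ?_
    have := sq_mul_exp_le_add (A := -(h x - inner ℝ z x)) (A' := -(h (-x) - inner ℝ z (-x)))
      (b := inner ℝ (c - z) x) (W := W * ‖x‖) (by
        have := hsym x
        rw [inner_neg_right]; linarith)
    simp only [hJexp, inner_neg_right (𝕜 := ℝ) (c - z) x, sub_neg_eq_add]
    rwa [show -(W * ‖x‖) / 2 = -(W / 2 * ‖x‖) by ring] at this
  rw [integral_inner_sq_mul_exp hd _ (by positivity), integral_add iJ iJ.comp_neg,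
    integral_neg_eq_self, hJi, one_div_div] at hle
  linarith

end Convexity

section Critical

variable {d : ℕ}

theorem deriv_nonneg_of_nonneg_right {f : ℝ → ℝ} {f' : ℝ} (hf : HasDerivAt f f' 0)
    (h0 : f 0 = 0) (hpos : ∀ᶠ t in 𝓝[>] 0, 0 ≤ f t) : 0 ≤ f' := by
  refine ge_of_tendsto hf.tendsto_slope_zero_right ?_
  filter_upwards [hpos, self_mem_nhdsWithin] with t hft (ht : 0 < t)
  rw [zero_add, h0, sub_zero]
  exact smul_nonneg (inv_nonneg.2 ht.le) hft

theorem integral_inner_mul_exp_neg_eq_zero (hd : d ≠ 0) {h : EuclideanSpace ℝ (Fin d) → ℝ}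
    (hh : Continuous h) {z : EuclideanSpace ℝ (Fin d)} {r δ : ℝ} (hr : 0 < r) (hδ : 0 < δ)
    (hz : ∀ x, r * ‖x‖ ≤ h x - inner ℝ z x)
    (hmin : ∀ c, ‖c - z‖ ≤ δ → ∫ x, Real.exp (-(h x - inner ℝ z x)) ≤
      ∫ x, Real.exp (-(h x - inner ℝ c x)))
    (v : EuclideanSpace ℝ (Fin d)) :
    ∫ x, inner ℝ v x * Real.exp (-(h x - inner ℝ z x)) = 0 := by
  have key : ∀ v : EuclideanSpace ℝ (Fin d),
      0 ≤ ∫ x, inner ℝ v x * Real.exp (-(h x - inner ℝ z x)) := by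
    intro v
    have hsmall : ∀ᶠ t in 𝓝[>] (0 : ℝ), t * ‖v‖ ≤ min δ (r / 2) := by
      have : Tendsto (fun t : ℝ => t * ‖v‖) (𝓝[>] 0) (𝓝 (0 * ‖v‖)) :=
        ((continuous_id.mul continuous_const).tendsto 0).mono_left nhdsWithin_le_nhds
      rw [zero_mul] at this
      exact (this.eventually (gt_mem_nhds (show (0 : ℝ) < min δ (r / 2) by positivity))).mono
        fun _ h => h.le
    have hbound : ∀ t : ℝ, 0 < t → t * ‖v‖ ≤ min δ (r / 2) → ∀ x,
        r / 2 * ‖x‖ ≤ h x - inner ℝ (z + t • v) x := by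
      intro t ht htv x
      have h1 := hz x
      have h2 : inner ℝ (t • v) x ≤ r / 2 * ‖x‖ := by
        refine (real_inner_le_norm _ _).trans ?_
        rw [norm_smul, Real.norm_of_nonneg ht.le]
        exact mul_le_mul_of_nonneg_right (htv.trans (min_le_right _ _)) (norm_nonneg _)
      rw [inner_add_left]; linarith
    have hlim : Tendsto (fun t : ℝ => ∫ x, inner ℝ v x *
        Real.exp (-(h x - inner ℝ (z + t • v) x))) (𝓝[>] 0)
        (𝓝 (∫ x, inner ℝ v x * Real.exp (-(h x - inner ℝ z x)))) := by
      refine tendsto_integral_filter_of_dominated_convergence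
        (fun x => ‖v‖ * (‖x‖ ^ 1 * Real.exp (-(r / 2 * ‖x‖)))) ?_ ?_ ?_ ?_
      · exact .of_forall fun t => (by fun_prop : Continuous _).aestronglyMeasurable
      · filter_upwards [hsmall, self_mem_nhdsWithin] with t ht (ht0 : 0 < t)
        refine .of_forall fun x => ?_
        rw [norm_mul, pow_one, ← mul_assoc, Real.norm_eq_abs, Real.norm_eq_abs, Real.abs_exp]
        exact mul_le_mul (abs_real_inner_le_norm v x)
          (Real.exp_le_exp.2 (neg_le_neg (hbound t ht0 ht x))) (Real.exp_nonneg _) (by positivity)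
      · exact (integrable_norm_pow_mul_exp hd 1 (by positivity)).const_mul _
      · refine .of_forall fun x => ?_
        have : Continuous fun t : ℝ => inner ℝ v x * Real.exp (-(h x - inner ℝ (z + t • v) x)) := by
          fun_prop
        have := (this.tendsto 0).mono_left (nhdsWithin_le_nhds (s := Ioi 0))
        simpa using this
    refine ge_of_tendsto hlim ?_
    filter_upwards [hsmall, self_mem_nhdsWithin] with t ht (ht0 : 0 < t)
    have hb := hbound t ht0 ht
    have i0 := integrable_exp_neg hd (by fun_prop) hr hz
    have it := integrable_exp_neg hd (by fun_prop) (by positivity) hb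
    have iv := integrable_inner_mul_exp_neg hd v (by fun_prop) (by positivity) hb
    have hm := hmin (z + t • v) (by
      rw [add_sub_cancel_left, norm_smul, Real.norm_of_nonneg ht0.le]
      exact ht.trans (min_le_left _ _))
    have hle : ∫ x, (Real.exp (-(h x - inner ℝ (z + t • v) x)) -
        t * (inner ℝ v x * Real.exp (-(h x - inner ℝ (z + t • v) x)))) ≤
        ∫ x, Real.exp (-(h x - inner ℝ z x)) := by
      refine integral_mono (it.sub (iv.const_mul t)) i0 fun x => ?_
      have e : -(h x - inner ℝ z x) =
          -(h x - inner ℝ (z + t • v) x) + -(t * inner ℝ v x) := by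
        rw [inner_add_left, real_inner_smul_left]; ring
      have := Real.add_one_le_exp (-(t * inner ℝ v x))
      simp only
      rw [e, Real.exp_add]
      nlinarith [Real.exp_pos (-(h x - inner ℝ (z + t • v) x))]
    rw [integral_sub it (iv.const_mul t), integral_const_mul] at hle
    exact nonneg_of_mul_nonneg_right (by linarith) ht0
  refine le_antisymm ?_ (key v)
  have := key (-v)
  simp only [inner_neg_left, neg_mul, integral_neg] at this
  linarith

theorem integral_mul_exp_neg_le (hd : d ≠ 0) {g : EuclideanSpace ℝ (Fin d) → ℝ}
    (hg : Continuous g) (hs : ∀ t, 0 ≤ t → ∀ x, g (t • x) = t * g x) {r C : ℝ} (hr : 0 < r)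
    (hgr : ∀ x, r * ‖x‖ ≤ g x) (hgC : ∀ x, g x ≤ C * ‖x‖) :
    ∫ x, g x * Real.exp (-g x) ≤ d * ∫ x, Real.exp (-g x) := by
  set Z := ∫ x, Real.exp (-g x)
  set A := ∫ x, g x * Real.exp (-g x)
  have hg0 : ∀ x, 0 ≤ g x := fun x => (by positivity : 0 ≤ r * ‖x‖).trans (hgr x)
  have iZ := integrable_exp_neg hd hg hr hgr
  have iA : Integrable fun x => g x * Real.exp (-g x) :=
    integrable_mul_exp_neg hd (k := 1) (C := C) hg hg hr
      (fun x => by rw [abs_of_nonneg (hg0 x), pow_one]; exact hgC x) hgr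
  have hscale : ∀ t : ℝ, 0 < t → t < 1 → 0 ≤ Z - (1 - t) ^ d * (Z + t * A) := by
    intro t ht0 ht1
    have ht : 0 < 1 - t := by linarith
    have h1 : ∫ x, Real.exp (-g ((1 - t) • x)) = ((1 - t) ^ d)⁻¹ * Z := by
      rw [Measure.integral_comp_smul volume (fun x => Real.exp (-g x)), finrank_euclideanSpace_fin,
        abs_of_pos (by positivity), smul_eq_mul]
    have h2 : Z + t * A ≤ ∫ x, Real.exp (-g ((1 - t) • x)) := by
      rw [← integral_const_mul, ← integral_add iZ (iA.const_mul t)]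
      refine integral_mono (iZ.add (iA.const_mul t))
        (integrable_exp_neg hd (r := (1 - t) * r) (by fun_prop) (by positivity) fun x => ?_)
        fun x => ?_
      · rw [hs _ ht.le, mul_assoc]
        exact mul_le_mul_of_nonneg_left (hgr x) ht.le
      · have := Real.add_one_le_exp (t * g x)
        simp only
        rw [hs _ ht.le, show -((1 - t) * g x) = -g x + t * g x by ring, Real.exp_add]
        nlinarith [Real.exp_pos (-g x)]
    rw [h1] at h2
    have := mul_le_mul_of_nonneg_left h2 (by positivity : 0 ≤ (1 - t) ^ d)
    rw [mul_inv_cancel_left₀ (by positivity)] at this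
    linarith
  have hder : HasDerivAt (fun t : ℝ => Z - (1 - t) ^ d * (Z + t * A)) (d * Z - A) 0 := by
    have := ((((hasDerivAt_id (0 : ℝ)).const_sub 1).pow d).mul
      (((hasDerivAt_id (0 : ℝ)).mul_const A).const_add Z)).const_sub Z
    refine this.congr_deriv ?_
    simp
    ring
  have := deriv_nonneg_of_nonneg_right hder (by simp) (by
    filter_upwards [Ioo_mem_nhdsGT (zero_lt_one' ℝ)] with t ht
    exact hscale t ht.1 ht.2)
  linarith

theorem neg_inner_le_of_centred (hd : d ≠ 0) {g : EuclideanSpace ℝ (Fin d) → ℝ}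
    (hg : Continuous g) (hs : ∀ t, 0 ≤ t → ∀ x, g (t • x) = t * g x)
    (hadd : ∀ x y, g (x + y) ≤ g x + g y) {r C : ℝ} (hr : 0 < r)
    (hgr : ∀ x, r * ‖x‖ ≤ g x) (hgC : ∀ x, g x ≤ C * ‖x‖)
    (hcrit : ∀ v, ∫ x, inner ℝ v x * Real.exp (-g x) = 0)
    {p : EuclideanSpace ℝ (Fin d)} (hp : ∀ x, inner ℝ p x ≤ g x)
    (y : EuclideanSpace ℝ (Fin d)) : -inner ℝ p y ≤ d * g y := by
  have hA := integral_mul_exp_neg_le hd hg hs hr hgr hgC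
  set Z := ∫ x, Real.exp (-g x)
  set A := ∫ x, g x * Real.exp (-g x)
  have hg0 : ∀ x, 0 ≤ g x := fun x => (by positivity : 0 ≤ r * ‖x‖).trans (hgr x)
  have iZ := integrable_exp_neg hd hg hr hgr
  have iA : Integrable fun x => g x * Real.exp (-g x) :=
    integrable_mul_exp_neg hd (k := 1) (C := C) hg hg hr
      (fun x => by rw [abs_of_nonneg (hg0 x), pow_one]; exact hgC x) hgr
  have ip := integrable_inner_mul_exp_neg hd p hg hr hgr
  have hZ : 0 < Z := integral_exp_pos iZ
  set γ := g y
  set τ := -inner ℝ p y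
  set ψ : EuclideanSpace ℝ (Fin d) → ℝ := fun x =>
    Real.exp (-g x) + g x * Real.exp (-g x) - inner ℝ p x * Real.exp (-g x)
  have iψ : Integrable ψ := (iZ.add iA).sub ip
  have hψ : ∫ x, ψ x = Z + A :=
    (integral_sub (iZ.add iA) ip).trans (by rw [hcrit, sub_zero]; exact integral_add iZ iA)
  have hshift : ∀ t : ℝ, 0 < t → 0 ≤ (Real.exp (t * γ) - 1) * (Z + A) - t * ((γ + τ) * Z) := by
    intro t ht
    have h1 : ∫ x, (ψ x + t * (γ + τ) * Real.exp (-g x)) ≤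
        ∫ x, Real.exp (t * γ) * ψ (x + t • y) := by
      refine integral_mono (iψ.add (iZ.const_mul _)) ((iψ.comp_add_right _).const_mul _)
        fun x => ?_
      have ha : g (x + t • y) ≤ g x + t * γ := by
        have := hadd x (t • y)
        rwa [hs t ht.le] at this
      have hc := hp (x + t • y)
      rw [inner_add_right, real_inner_smul_right] at hc
      have he := Real.add_one_le_exp (g x + t * γ - g (x + t • y))
      have e : Real.exp (t * γ) * Real.exp (-g (x + t • y)) =
          Real.exp (-g x) * Real.exp (g x + t * γ - g (x + t • y)) := by
        rw [← Real.exp_add, ← Real.exp_add]; ring_nf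
      simp only [ψ]
      rw [inner_add_right, real_inner_smul_right]
      calc _ = Real.exp (-g x) * (1 + g x - inner ℝ p x + t * (γ + τ)) := by ring
        _ ≤ Real.exp (-g x) * (Real.exp (g x + t * γ - g (x + t • y)) *
            (1 + g (x + t • y) - inner ℝ p x - t * inner ℝ p y)) := by
          gcongr
          simp only [τ]
          nlinarith
        _ = (Real.exp (t * γ) * Real.exp (-g (x + t • y))) *
            (1 + g (x + t • y) - inner ℝ p x - t * inner ℝ p y) := by rw [e]; ring
        _ = _ := by ring
    rw [integral_const_mul, integral_add_right_eq_self ψ, integral_add iψ (iZ.const_mul _),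
      integral_const_mul, hψ] at h1
    linarith
  have hder : HasDerivAt (fun t : ℝ => (Real.exp (t * γ) - 1) * (Z + A) - t * ((γ + τ) * Z))
      (γ * (Z + A) - (γ + τ) * Z) 0 := by
    have := (((((hasDerivAt_id (0 : ℝ)).mul_const γ).exp).sub_const 1).mul_const (Z + A)).sub
      ((hasDerivAt_id (0 : ℝ)).mul_const ((γ + τ) * Z))
    refine this.congr_deriv ?_
    simp
  have h0 := deriv_nonneg_of_nonneg_right hder (by simp) (by
    filter_upwards [self_mem_nhdsWithin] with t (ht : 0 < t) using hshift t ht)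
  have hγ : 0 ≤ γ := hg0 y
  have : τ * Z ≤ (d * γ) * Z := by nlinarith
  exact le_of_mul_le_mul_right this hZ

end Critical

section Santalo

variable {d : ℕ} {K : Set (EuclideanSpace ℝ (Fin d))}

theorem lowerSemicontinuous_lintegral_exp (h : EuclideanSpace ℝ (Fin d) → ℝ) (hh : Continuous h) :
    LowerSemicontinuous fun z => ∫⁻ x, ENNReal.ofReal (Real.exp (-(h x - inner ℝ z x))) := by
  intro a y hy
  refine eventually_lt_of_lt_liminf (hy.trans_le ?_)
  refine le_trans (le_of_eq ?_) (lintegral_liminf_le fun z => by fun_prop)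
  refine lintegral_congr fun x => (Tendsto.liminf_eq ?_).symm
  have : Continuous fun z => ENNReal.ofReal (Real.exp (-(h x - inner ℝ z x))) :=
    ENNReal.continuous_ofReal.comp (by fun_prop)
  exact this.tendsto a

theorem mem_interior_of_lintegral_ne_top (hK : IsSolidConvexBody K)
    {z : EuclideanSpace ℝ (Fin d)} (hz : z ∈ K)
    (hfin : ∫⁻ x, ENNReal.ofReal (Real.exp (-(supportFn K x - inner ℝ z x))) ≠ ⊤) :
    z ∈ interior K := by
  have hne : K.Nonempty := ⟨z, hz⟩
  have hc := continuous_supportFn hK.isCompact hne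
  by_contra hzi
  obtain ⟨f, hf⟩ := geometric_hahn_banach_open_point hK.convex.interior isOpen_interior hzi
  set u := (InnerProductSpace.toDual ℝ (EuclideanSpace ℝ (Fin d))).symm f
  have hu : ∀ y, inner ℝ u y = f y := fun y => InnerProductSpace.toDual_symm_apply
  obtain ⟨z₁, hz₁⟩ := hK.interior_nonempty
  have hu0 : u ≠ 0 := by
    intro h0
    have := hf z₁ hz₁
    rw [← hu, ← hu, h0] at this
    simp at this
  set G : EuclideanSpace ℝ (Fin d) → ℝ := fun x => supportFn K x - inner ℝ z x
  have hGu : G u ≤ 0 := by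
    have : supportFn K u ≤ inner ℝ u z := by
      refine supportFn_le hne fun y hy => ?_
      have hy' : y ∈ closure (interior K) := by
        rw [hK.convex.closure_interior_eq_closure_of_nonempty_interior hK.interior_nonempty]
        exact subset_closure hy
      have hcl : IsClosed {y | inner ℝ u y ≤ inner ℝ u z} :=
        isClosed_le (by fun_prop) (by fun_prop)
      refine closure_minimal (fun a ha => ?_) hcl hy'
      have := hf a ha
      rw [← hu, ← hu] at this
      exact this.le
    rw [real_inner_comm] at this
    simp only [G]; linarith
  have hGnu : 0 < G (-u) := by
    obtain ⟨r, hr, h⟩ := exists_le_supportFn_of_mem_interior hK.isCompact hz₁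
    have h1 := h u
    have h2 := h (-u)
    have h3 : 0 < r * ‖u‖ := mul_pos hr (norm_pos_iff.2 hu0)
    simp only [G, inner_neg_right, norm_neg] at *
    linarith
  have hGadd : ∀ x, G (x + u) ≤ G x := by
    intro x
    have := supportFn_add_le hK.isCompact hne x u
    simp only [G, inner_add_right] at *
    linarith
  have hGc : Continuous G := by fun_prop
  have hint : Integrable fun x => Real.exp (-G x) := by
    refine ⟨(by fun_prop : Continuous _).aestronglyMeasurable, ?_⟩
    rw [hasFiniteIntegral_iff_ofReal (.of_forall fun _ => Real.exp_nonneg _)]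
    exact hfin.lt_top
  have hz0 : ∫ x, (Real.exp (-G (x + u)) - Real.exp (-G x)) = 0 := by
    rw [integral_sub (hint.comp_add_right u) hint,
      integral_add_right_eq_self (fun x => Real.exp (-G x)), sub_self]
  have hae := (integral_eq_zero_iff_of_nonneg
    (fun x => sub_nonneg.2 (Real.exp_le_exp.2 (neg_le_neg (hGadd x))))
    ((hint.comp_add_right u).sub hint)).1 hz0
  have heq := (Continuous.ae_eq_iff_eq volume
    ((by fun_prop : Continuous fun x => Real.exp (-G (x + u))).sub
      (by fun_prop : Continuous fun x => Real.exp (-G x))) continuous_zero).1 hae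
  have := congrFun heq (-u)
  simp only [Pi.sub_apply, neg_add_cancel, Pi.zero_apply] at this
  have hG00 : G 0 = 0 := by simp [G, supportFn_zero hne]
  rw [hG00, sub_eq_zero, Real.exp_eq_exp] at this
  linarith

theorem volume_real_convexPolar_le_iff (hK : IsSolidConvexBody K)
    {s z : EuclideanSpace ℝ (Fin d)} (hs : s ∈ K) (hz : z ∈ K) :
    volume.real (convexPolar (K - {s})) ≤ volume.real (convexPolar (K - {z})) ↔
      ∫ x, Real.exp (-(supportFn K x - inner ℝ s x)) ≤
        ∫ x, Real.exp (-(supportFn K x - inner ℝ z x)) := by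
  rw [volume_real_convexPolar hK.isCompact hs, volume_real_convexPolar hK.isCompact hz,
    mul_le_mul_iff_of_pos_left (by positivity)]

theorem exists_isSantaloPoint (hd : d ≠ 0) (hK : IsSolidConvexBody K) :
    ∃ s, IsSantaloPoint K s := by
  obtain ⟨z₁, hz₁⟩ := hK.interior_nonempty
  have hne : K.Nonempty := ⟨z₁, interior_subset hz₁⟩
  have hc := continuous_supportFn hK.isCompact hne
  obtain ⟨s, hs, hmin⟩ := ((lowerSemicontinuous_lintegral_exp _ hc).lowerSemicontinuousOn K).exists_isMinOn
    hne hK.isCompact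
  have hfin : ∀ z ∈ interior K,
      ∫⁻ x, ENNReal.ofReal (Real.exp (-(supportFn K x - inner ℝ z x))) ≠ ⊤ := by
    intro z hz
    obtain ⟨r, hr, h⟩ := exists_le_supportFn_of_mem_interior hK.isCompact hz
    have := (integrable_exp_neg hd (by fun_prop) hr h).2
    rw [hasFiniteIntegral_iff_ofReal (.of_forall fun _ => Real.exp_nonneg _)] at this
    exact this.ne
  refine ⟨s, mem_interior_of_lintegral_ne_top hK hs
    (ne_top_of_le_ne_top (hfin z₁ hz₁) (hmin (interior_subset hz₁))), fun z hz => ?_⟩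
  rw [volume_real_convexPolar_le_iff hK hs (interior_subset hz),
    integral_eq_lintegral_of_nonneg_ae (.of_forall fun _ => Real.exp_nonneg _)
      (by fun_prop : Continuous _).aestronglyMeasurable,
    integral_eq_lintegral_of_nonneg_ae (.of_forall fun _ => Real.exp_nonneg _)
      (by fun_prop : Continuous _).aestronglyMeasurable]
  exact ENNReal.toReal_mono (hfin z hz) (hmin (interior_subset hz))

theorem isSantaloPoint_santaloPoint (hd : d ≠ 0) (hK : IsSolidConvexBody K) :
    IsSantaloPoint K (santaloPoint K) :=
  Classical.epsilon_spec (exists_isSantaloPoint hd hK)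

theorem IsSantaloPoint.integral_inner_mul_exp_eq_zero (hd : d ≠ 0) (hK : IsSolidConvexBody K)
    {s : EuclideanSpace ℝ (Fin d)} (hs : IsSantaloPoint K s) (v : EuclideanSpace ℝ (Fin d)) :
    ∫ x, inner ℝ v x * Real.exp (-(supportFn K x - inner ℝ s x)) = 0 := by
  obtain ⟨r, hr, h⟩ := exists_le_supportFn_of_mem_interior hK.isCompact hs.1
  obtain ⟨δ, hδ, hball⟩ :=
    Metric.nhds_basis_closedBall.mem_iff.1 (isOpen_interior.mem_nhds hs.1)
  refine integral_inner_mul_exp_neg_eq_zero hd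
    (continuous_supportFn hK.isCompact ⟨s, interior_subset hs.1⟩) hr hδ h (fun c hc => ?_) v
  have hcK : c ∈ interior K := hball (by rwa [Metric.mem_closedBall, dist_eq_norm])
  rw [← volume_real_convexPolar_le_iff hK (interior_subset hs.1) (interior_subset hcK)]
  exact hs.2 c hcK

/-- The Santaló point divides the width of a convex body in each direction in a ratio
at most `d : 1`. -/
theorem IsSantaloPoint.width_le (hd : d ≠ 0) (hK : IsSolidConvexBody K)
    {s : EuclideanSpace ℝ (Fin d)} (hs : IsSantaloPoint K s) (u : EuclideanSpace ℝ (Fin d)) :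
    supportFn K u + supportFn K (-u) ≤ (d + 1) * (supportFn K u - inner ℝ s u) := by
  have hne : K.Nonempty := ⟨s, interior_subset hs.1⟩
  have hc := continuous_supportFn hK.isCompact hne
  obtain ⟨r, hr, h⟩ := exists_le_supportFn_of_mem_interior hK.isCompact hs.1
  obtain ⟨y, hy, hyu⟩ := exists_inner_eq_supportFn hK.isCompact hne (-u)
  have := neg_inner_le_of_centred hd (g := fun x => supportFn K x - inner ℝ s x) (by fun_prop)
    (C := Metric.diam K) (fun t ht x => by
      rw [supportFn_smul hK.isCompact hne ht, real_inner_smul_right]; ring)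
    (fun x y => by
      have := supportFn_add_le hK.isCompact hne x y
      rw [inner_add_right]; linarith) hr h (fun x => by
      have h1 := supportFn_add_supportFn_neg_le hK.isCompact hne x
      have h2 := inner_le_supportFn hK.isCompact (-x) (interior_subset hs.1)
      rw [inner_neg_left, real_inner_comm] at h2
      linarith) (hs.integral_inner_mul_exp_eq_zero hd hK) (p := y - s) (fun x => by
      have := inner_le_supportFn hK.isCompact x hy
      rw [real_inner_comm] at this
      rw [inner_sub_left]; linarith) u
  rw [inner_sub_left] at this
  rw [inner_neg_left, real_inner_comm] at hyu
  linarith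

end Santalo

section Enclosing

variable {d : ℕ} {K : Set (EuclideanSpace ℝ (Fin d))}

/-- A compact set of diameter `D` lies in a ball of radius `D / √2`. -/
theorem exists_forall_norm_sub_sq_le (hK : IsCompact K) (hne : K.Nonempty) :
    ∃ c, ∀ x ∈ K, ‖x - c‖ ^ 2 ≤ Metric.diam K ^ 2 / 2 := by
  set D := Metric.diam K
  set φ : EuclideanSpace ℝ (Fin d) → EuclideanSpace ℝ (Fin d) × ℝ := fun x => (x, ‖x‖ ^ 2)
  set H := closure (convexHull ℝ (φ '' K))
  have hφK : IsCompact (φ '' K) := hK.image (by fun_prop)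
  have hHconv : Convex ℝ H := (convex_convexHull ℝ _).closure
  have hHK : ∀ x ∈ K, φ x ∈ H := fun x hx =>
    subset_closure (subset_convexHull ℝ _ (mem_image_of_mem φ hx))
  have hHcomp : IsCompact H :=
    Metric.isCompact_of_isClosed_isBounded isClosed_closure
      (isBounded_convexHull.2 hφK.isBounded).closure
  have hmin : ∀ (a : EuclideanSpace ℝ (Fin d)) (b : ℝ),
      (∀ x ∈ K, ‖x‖ ^ 2 + inner ℝ a x ≤ b) → ∀ p ∈ H, p.2 + inner ℝ a p.1 ≤ b := by
    intro a b hab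
    have hcl : IsClosed {p : EuclideanSpace ℝ (Fin d) × ℝ | p.2 + inner ℝ a p.1 ≤ b} :=
      isClosed_le (by fun_prop) (by fun_prop)
    refine closure_minimal (convexHull_min ?_ ?_) hcl
    · rintro _ ⟨x, hx, rfl⟩
      exact hab x hx
    · intro p hp q hq s t hs ht hst
      change p.2 + inner ℝ a p.1 ≤ b at hp
      change q.2 + inner ℝ a q.1 ≤ b at hq
      change (s • p + t • q).2 + inner ℝ a (s • p + t • q).1 ≤ b
      rw [Prod.fst_add, Prod.snd_add, Prod.smul_fst, Prod.smul_snd, Prod.smul_fst, Prod.smul_snd,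
        inner_add_right, real_inner_smul_right, real_inner_smul_right, smul_eq_mul, smul_eq_mul]
      calc _ = s * (p.2 + inner ℝ a p.1) + t * (q.2 + inner ℝ a q.1) := by ring
        _ ≤ s * b + t * b := by gcongr
        _ = b := by rw [← add_mul, hst, one_mul]
  have hvar : ∀ p ∈ H, p.2 - ‖p.1‖ ^ 2 ≤ D ^ 2 / 2 := by
    intro p hp
    have h1 : ∀ y ∈ K, p.2 + inner ℝ ((-2 : ℝ) • y) p.1 ≤ D ^ 2 - ‖y‖ ^ 2 := by
      intro y hy
      refine hmin _ _ (fun x hx => ?_) p hp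
      have h := Metric.dist_le_diam_of_mem hK.isBounded hx hy
      rw [dist_eq_norm] at h
      have h2 := pow_le_pow_left₀ (norm_nonneg _) h 2
      rw [norm_sub_sq_real, real_inner_comm] at h2
      rw [real_inner_smul_left]
      linarith
    have h2 := hmin ((-2 : ℝ) • p.1) (D ^ 2 - p.2) (fun y hy => by
      have := h1 y hy
      rw [real_inner_smul_left, real_inner_comm] at this
      rw [real_inner_smul_left]
      linarith) p hp
    rw [real_inner_smul_left, real_inner_self_eq_norm_sq] at h2
    linarith
  obtain ⟨x₀, hx₀⟩ := hne
  obtain ⟨p, hp, hpmax⟩ := hHcomp.exists_isMaxOn ⟨_, hHK x₀ hx₀⟩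
    (f := fun p => p.2 - ‖p.1‖ ^ 2) (by fun_prop)
  refine ⟨p.1, fun x hx => ?_⟩
  have hder : 0 ≤ p.2 - ‖p.1‖ ^ 2 - ‖x - p.1‖ ^ 2 := by
    have hd : HasDerivAt (fun t : ℝ => t * (p.2 - ‖p.1‖ ^ 2) - t * (1 - t) * ‖x - p.1‖ ^ 2)
        (p.2 - ‖p.1‖ ^ 2 - ‖x - p.1‖ ^ 2) 0 := by
      have := ((hasDerivAt_id (0 : ℝ)).mul_const (p.2 - ‖p.1‖ ^ 2)).sub
        (((hasDerivAt_id (0 : ℝ)).mul ((hasDerivAt_id (0 : ℝ)).const_sub 1)).mul_const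
          (‖x - p.1‖ ^ 2))
      refine this.congr_deriv ?_
      simp
    refine deriv_nonneg_of_nonneg_right hd (by simp) ?_
    filter_upwards [Ioo_mem_nhdsGT (zero_lt_one' ℝ)] with t ht
    have hq := hHconv hp (hHK x hx) (sub_nonneg.2 ht.2.le) ht.1.le (sub_add_cancel 1 t)
    have hle : _ ≤ p.2 - ‖p.1‖ ^ 2 := hpmax hq
    simp only [φ, Prod.fst_add, Prod.snd_add, Prod.smul_fst, Prod.smul_snd, smul_eq_mul] at hle
    rw [norm_add_sq_real, norm_smul, norm_smul, real_inner_smul_left, real_inner_smul_right,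
      Real.norm_of_nonneg ht.1.le, Real.norm_of_nonneg (sub_nonneg.2 ht.2.le)] at hle
    rw [norm_sub_sq_real, real_inner_comm]
    nlinarith
  have := hvar p hp
  linarith

end Enclosing

section Slab

theorem volume_slab_inter_ball_le {n : ℕ} (hn : n ≠ 0) {u c : EuclideanSpace ℝ (Fin (n + 1))}
    (hu : ‖u‖ = 1) (α w R : ℝ) :
    volume {x | inner ℝ u x ∈ Icc α (α + w) ∧ ‖x - c‖ < R} ≤
      ENNReal.ofReal w * (ENNReal.ofReal R ^ n * ENNReal.ofReal (unitBallVolume n)) := by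
  obtain ⟨b, hb⟩ := Orthonormal.exists_orthonormalBasis_extension_of_card_eq
    (𝕜 := ℝ) (E := EuclideanSpace ℝ (Fin (n + 1))) (ι := Fin (n + 1)) (by simp)
    (v := fun _ => u) (s := {0}) (by
      rw [orthonormal_iff_ite]
      intro i j
      have : i = j := Subsingleton.elim _ _
      simp [this, hu])
  have hb0 : b 0 = u := hb 0 rfl
  set Φ : EuclideanSpace ℝ (Fin (n + 1)) → ℝ × (Fin n → ℝ) :=
    fun x => MeasurableEquiv.piFinSuccAbove (fun _ => ℝ) 0
      ((MeasurableEquiv.toLp 2 (Fin (n + 1) → ℝ)).symm (b.repr x))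
  have hΦ : MeasurePreserving Φ volume volume :=
    ((volume_preserving_piFinSuccAbove (fun _ : Fin (n + 1) => ℝ) 0).comp
      (EuclideanSpace.volume_preserving_symm_measurableEquiv_toLp (Fin (n + 1)))).comp
      b.measurePreserving_repr
  set T : Set (Fin n → ℝ) :=
    (MeasurableEquiv.toLp 2 (Fin n → ℝ)) ⁻¹' Metric.ball (WithLp.toLp 2 (Φ c).2) R
  have hTm : MeasurableSet T := (MeasurableEquiv.toLp 2 (Fin n → ℝ)).measurable
    Metric.isOpen_ball.measurableSet
  have hT : volume T = ENNReal.ofReal R ^ n * ENNReal.ofReal (unitBallVolume n) := by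
    rw [← volume_ball_eq_unitBallVolume hn (WithLp.toLp 2 (Φ c).2) R]
    exact (PiLp.volume_preserving_toLp (Fin n)).measure_preimage
      Metric.isOpen_ball.measurableSet.nullMeasurableSet
  calc volume {x | inner ℝ u x ∈ Icc α (α + w) ∧ ‖x - c‖ < R}
      ≤ volume (Φ ⁻¹' (Icc α (α + w) ×ˢ T)) := by
        refine measure_mono fun x ⟨h1, h2⟩ => ⟨?_, ?_⟩
        · have : (Φ x).1 = inner ℝ u x := by
            rw [← hb0, ← b.repr_apply_apply]; rfl
          rw [this]; exact h1
        · have h3 : ‖b.repr x - b.repr c‖ < R := by rwa [← map_sub, LinearIsometryEquiv.norm_map]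
          refine lt_of_le_of_lt ?_ h3
          rw [dist_eq_norm, EuclideanSpace.norm_eq, EuclideanSpace.norm_eq, Fin.sum_univ_succ]
          refine Real.sqrt_le_sqrt ?_
          have : ∀ i : Fin n, ((MeasurableEquiv.toLp 2 (Fin n → ℝ)) (Φ x).2 -
              WithLp.toLp 2 (Φ c).2) i = (b.repr x - b.repr c) i.succ := fun i => rfl
          simp_rw [this]
          nlinarith [sq_nonneg ‖(b.repr x - b.repr c) 0‖]
    _ = volume (Icc α (α + w) ×ˢ T) :=
        hΦ.measure_preimage (measurableSet_Icc.prod hTm).nullMeasurableSet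
    _ = _ := by
        rw [Measure.volume_eq_prod, Measure.prod_prod, Real.volume_Icc, hT, add_sub_cancel_left]

theorem volume_real_le_width_mul {d : ℕ} (hd : 2 ≤ d) {K : Set (EuclideanSpace ℝ (Fin d))}
    (hK : IsCompact K) (hne : K.Nonempty) {u : EuclideanSpace ℝ (Fin d)} (hu : ‖u‖ = 1) :
    volume.real K ≤ (supportFn K u + supportFn K (-u)) *
      ((Metric.diam K / √2) ^ (d - 1) * unitBallVolume (d - 1)) := by
  obtain ⟨n, rfl⟩ : ∃ n, d = n + 1 := ⟨d - 1, by omega⟩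
  rw [Nat.add_sub_cancel]
  have hn : n ≠ 0 := by omega
  obtain ⟨c, hc⟩ := exists_forall_norm_sub_sq_le hK hne
  set ω := supportFn K u + supportFn K (-u)
  have hω : 0 ≤ ω := by
    have := supportFn_add_le hK hne u (-u)
    rwa [add_neg_cancel, supportFn_zero hne] at this
  have hD : 0 ≤ Metric.diam K / √2 := div_nonneg Metric.diam_nonneg (Real.sqrt_nonneg _)
  have hle : ∀ R, Metric.diam K / √2 < R → volume.real K ≤ ω * (R ^ n * unitBallVolume n) := by
    intro R hR
    have hR0 : 0 ≤ R := hD.trans hR.le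
    have hsub : K ⊆ {x | inner ℝ u x ∈ Icc (-supportFn K (-u)) (-supportFn K (-u) + ω) ∧
        ‖x - c‖ < R} := by
      intro x hx
      have h1 := inner_le_supportFn hK u hx
      have h2 := inner_le_supportFn hK (-u) hx
      rw [inner_neg_left] at h2
      refine ⟨⟨by linarith, by simp only [ω]; linarith⟩, lt_of_le_of_lt ?_ hR⟩
      refine abs_le_of_sq_le_sq' ?_ hD |>.2
      rw [div_pow, Real.sq_sqrt zero_le_two]
      exact hc x hx
    have h := (measure_mono hsub).trans (volume_slab_inter_ball_le hn hu _ ω R)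
    rw [Measure.real]
    refine ENNReal.toReal_le_of_le_ofReal
      (mul_nonneg hω (mul_nonneg (pow_nonneg hR0 _) (unitBallVolume_pos n).le)) (h.trans ?_)
    rw [ENNReal.ofReal_mul hω, ENNReal.ofReal_mul (by positivity), ENNReal.ofReal_pow hR0]
  have hlim : Tendsto (fun R : ℝ => ω * (R ^ n * unitBallVolume n)) (𝓝[>] (Metric.diam K / √2))
      (𝓝 (ω * ((Metric.diam K / √2) ^ n * unitBallVolume n))) :=
    ((by fun_prop : Continuous fun R : ℝ => ω * (R ^ n * unitBallVolume n)).tendsto _).mono_left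
      nhdsWithin_le_nhds
  refine ge_of_tendsto hlim ?_
  filter_upwards [self_mem_nhdsWithin] with R hR using hle R hR

end Slab

section UnitBallVolume

theorem unitBallVolume_zero : unitBallVolume 0 = 1 := by
  simp [unitBallVolume]

theorem unitBallVolume_one : unitBallVolume 1 = 2 := by
  have hpi : √Real.pi ≠ 0 := (Real.sqrt_pos.2 Real.pi_pos).ne'
  rw [← sqrt_pi_pow_div_Gamma, Nat.cast_one, Real.Gamma_add_one (by norm_num),
    Real.Gamma_one_half_eq]
  field_simp

theorem unitBallVolume_add_two (n : ℕ) :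
    unitBallVolume (n + 2) = unitBallVolume n * (2 * Real.pi / (n + 2)) := by
  have hG : Real.Gamma ((n : ℝ) / 2 + 1) ≠ 0 := (Real.Gamma_pos_of_pos (by positivity)).ne'
  rw [unitBallVolume, unitBallVolume, Nat.cast_add, Nat.cast_two,
    show ((n : ℝ) + 2) / 2 = n / 2 + 1 by ring, Real.rpow_add Real.pi_pos, Real.rpow_one,
    Real.Gamma_add_one (s := (n : ℝ) / 2 + 1) (by positivity)]
  field_simp

theorem unitBallVolume_le_succ (n : ℕ) :
    2 * unitBallVolume n ≤ (n + 1) * unitBallVolume (n + 1) := by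
  induction n using Nat.twoStepInduction with
  | zero => rw [unitBallVolume_zero, unitBallVolume_one]; norm_num
  | one =>
    rw [unitBallVolume_one, unitBallVolume_add_two 0, unitBallVolume_zero]
    have := Real.pi_gt_three
    norm_num
    linarith
  | more n ih _ =>
    rw [unitBallVolume_add_two, show n + 2 + 1 = (n + 1) + 2 by ring, unitBallVolume_add_two]
    have hpos := unitBallVolume_pos (n + 1)
    have hpi := Real.pi_pos
    calc 2 * (unitBallVolume n * (2 * Real.pi / (n + 2)))
        = 2 * unitBallVolume n * (2 * Real.pi / (n + 2)) := by ring
      _ ≤ (n + 1) * unitBallVolume (n + 1) * (2 * Real.pi / (n + 2)) := by gcongr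
      _ = unitBallVolume (n + 1) * (2 * Real.pi) * ((n + 1) / (n + 2)) := by ring
      _ ≤ unitBallVolume (n + 1) * (2 * Real.pi) * 1 := by
        gcongr
        rw [div_le_one (by positivity)]; linarith
      _ = _ := by
        push_cast
        field_simp
        ring

theorem unitBallVolume_sq_le (n : ℕ) :
    6 / 5 * ((n + 3) * unitBallVolume (n + 1) ^ 2) ≤
      √2 ^ (n + 3) * ((n + 2) * unitBallVolume (n + 2)) := by
  have hs2 : √2 ^ 2 = 2 := Real.sq_sqrt zero_le_two
  have hs : 1.4 ≤ √2 := Real.le_sqrt_of_sq_le (by norm_num)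
  have hpi := Real.pi_gt_d2
  have hpi' := Real.pi_lt_d2
  have k2 : unitBallVolume 2 = Real.pi := by
    rw [unitBallVolume_add_two 0, unitBallVolume_zero]; norm_num
  have k3 : unitBallVolume 3 = 4 / 3 * Real.pi := by
    rw [unitBallVolume_add_two 1, unitBallVolume_one]; norm_num; ring
  have k4 : unitBallVolume 4 = Real.pi ^ 2 / 2 := by
    rw [unitBallVolume_add_two 2, k2]; norm_num; ring
  have key : ∀ n : ℕ, 6 / 5 * ((n + 4) * unitBallVolume (n + 2) ^ 2) ≤
      √2 ^ (n + 4) * ((n + 3) * unitBallVolume (n + 3)) := by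
    intro n
    induction n using Nat.twoStepInduction with
    | zero =>
      rw [show √2 ^ (0 + 4) = 4 by rw [zero_add, show (4 : ℕ) = 2 * 2 by rfl, pow_mul, hs2]; norm_num]
      simp only [zero_add, k2, k3, Nat.cast_zero]
      nlinarith
    | one =>
      rw [show √2 ^ (1 + 4) = 4 * √2 by
        rw [show 1 + 4 = 2 * 2 + 1 by rfl, pow_succ, pow_mul, hs2]; norm_num]
      simp only [Nat.reduceAdd, k3, k4, Nat.cast_one]
      nlinarith [mul_le_mul_of_nonneg_right hs (sq_nonneg Real.pi), sq_nonneg Real.pi]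
    | more n ih _ =>
      have h2 := unitBallVolume_add_two (n + 2)
      have h3 := unitBallVolume_add_two (n + 3)
      rw [show n + 2 + 3 = n + 3 + 2 by ring, h2, h3, show n + 2 + 4 = n + 4 + 2 by ring, pow_add,
        hs2]
      push_cast at *
      have hpos := unitBallVolume_pos (n + 3)
      have hn : (0 : ℝ) ≤ n := n.cast_nonneg
      set P := Real.pi
      calc 6 / 5 * (((n : ℝ) + 2 + 4) * (unitBallVolume (n + 2) * (2 * P / (n + 2 + 2))) ^ 2)
          = 6 / 5 * ((n + 4) * unitBallVolume (n + 2) ^ 2) *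
            ((n + 6) / (n + 4) * (2 * P / (n + 4)) ^ 2) := by field_simp; ring
        _ ≤ √2 ^ (n + 4) * ((n + 3) * unitBallVolume (n + 3)) *
            ((n + 6) / (n + 4) * (2 * P / (n + 4)) ^ 2) := by gcongr
        _ = √2 ^ (n + 4) * unitBallVolume (n + 3) * P *
            (4 * (P * ((n + 3) * (n + 6))) / (n + 4) ^ 3) := by field_simp; ring
        _ ≤ √2 ^ (n + 4) * unitBallVolume (n + 3) * P * 4 := by
          gcongr
          rw [div_le_iff₀ (by positivity)]
          have : P * (((n : ℝ) + 3) * (n + 6)) ≤ 3.15 * ((n + 3) * (n + 6)) := by gcongr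
          nlinarith [mul_nonneg hn hn, mul_nonneg hn (mul_nonneg hn hn)]
        _ = √2 ^ (n + 4) * 2 * (((n : ℝ) + 2 + 3) *
            (unitBallVolume (n + 3) * (2 * P / (n + 3 + 2)))) := by field_simp; ring
  cases n with
  | zero =>
    rw [show √2 ^ (0 + 3) = 2 * √2 by rw [zero_add, pow_succ, hs2]]
    simp only [zero_add, unitBallVolume_one, k2, Nat.cast_zero]
    nlinarith
  | succ n =>
    have := key n
    rw [show n + 1 + 3 = n + 4 by ring, show n + 1 + 2 = n + 3 by ring]
    push_cast
    convert this using 3 <;> ring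

end UnitBallVolume

section Stability

variable {d : ℕ}

theorem abs_exp_neg_sub_exp_neg_le {p q t : ℝ} (hp : t ≤ p) (hq : t ≤ q) :
    |Real.exp (-p) - Real.exp (-q)| ≤ |p - q| * Real.exp (-t) := by
  have key : ∀ p q : ℝ, t ≤ p → p ≤ q →
      |Real.exp (-p) - Real.exp (-q)| ≤ |p - q| * Real.exp (-t) := by
    intro p q hp hpq
    rw [abs_of_nonneg (sub_nonneg.2 (Real.exp_le_exp.2 (neg_le_neg hpq))), abs_sub_comm,
      abs_of_nonneg (sub_nonneg.2 hpq)]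
    have h1 : Real.exp (-q) = Real.exp (-p) * Real.exp (p - q) := by
      rw [← Real.exp_add]; ring_nf
    have h2 := Real.add_one_le_exp (p - q)
    have h3 : Real.exp (-p) ≤ Real.exp (-t) := Real.exp_le_exp.2 (neg_le_neg hp)
    rw [h1]
    nlinarith [Real.exp_pos (-p)]
  rcases le_total p q with h | h
  · exact key p q hp h
  · rw [abs_sub_comm, abs_sub_comm p]
    exact key q p hq h

theorem norm_sub_le_of_critical (hd : d ≠ 0) {h h₀ : EuclideanSpace ℝ (Fin d) → ℝ}
    (hh : Continuous h) (hh₀ : Continuous h₀) {W r r' η : ℝ} (hW : 0 < W) (hr : 0 < r)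
    (hr' : 0 < r') (hη : 0 ≤ η) (hsym : ∀ x, h x + h (-x) ≤ W * ‖x‖)
    {s s₀ z : EuclideanSpace ℝ (Fin d)}
    (hz : ∀ x, r * ‖x‖ ≤ h x - inner ℝ z x) (hs : ∀ x, r' * ‖x‖ ≤ h x - inner ℝ s x)
    (hs₀ : ∀ x, r * ‖x‖ ≤ h₀ x - inner ℝ s₀ x)
    (hdiff : ∀ x, |(h x - inner ℝ z x) - (h₀ x - inner ℝ s₀ x)| ≤ η * ‖x‖)
    (crit : ∀ v, ∫ x, inner ℝ v x * Real.exp (-(h x - inner ℝ s x)) = 0)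
    (crit₀ : ∀ v, ∫ x, inner ℝ v x * Real.exp (-(h₀ x - inner ℝ s₀ x)) = 0) :
    ‖s - z‖ ≤ η * d * (W / (2 * r)) ^ (d + 2) := by
  have hm : 0 < min r r' := lt_min hr hr'
  have hz' : ∀ x, min r r' * ‖x‖ ≤ h x - inner ℝ z x := fun x =>
    (mul_le_mul_of_nonneg_right (min_le_left _ _) (norm_nonneg x)).trans (hz x)
  have hs' : ∀ x, min r r' * ‖x‖ ≤ h x - inner ℝ s x := fun x =>
    (mul_le_mul_of_nonneg_right (min_le_right _ _) (norm_nonneg x)).trans (hs x)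
  have h1 := add_sq_le_integral_exp hd hh hW hm hsym hz' hs'
  have h2 := add_sq_le_integral_exp hd hh hW hm hsym hs' hz'
  rw [crit, norm_sub_rev] at h2
  set δ := ‖s - z‖
  have i0 := integrable_inner_mul_exp_neg hd (s - z) (by fun_prop) hr hs₀
  have iz := integrable_inner_mul_exp_neg hd (s - z) (by fun_prop) hr hz
  have hgrad : -∫ x, inner ℝ (s - z) x * Real.exp (-(h x - inner ℝ z x)) ≤
      δ * η * (d * unitBallVolume d * ((1 / r) ^ (d + 2) * (d + 1).factorial)) := by
    rw [← zero_sub, ← crit₀ (s - z), ← integral_sub i0 iz,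
      ← show d + 2 - 1 = d + 1 by omega, ← integral_norm_pow_mul_exp hd 2 hr, ← integral_const_mul]
    refine integral_mono (i0.sub iz) ((integrable_norm_pow_mul_exp hd 2 hr).const_mul _)
      fun x => ?_
    have ha := abs_exp_neg_sub_exp_neg_le (hs₀ x) (hz x)
    rw [abs_sub_comm (h₀ x - _)] at ha
    have hb := abs_real_inner_le_norm (s - z) x
    simp only
    rw [← mul_sub]
    refine (le_abs_self _).trans ?_
    rw [abs_mul]
    calc _ ≤ (δ * ‖x‖) * (η * ‖x‖ * Real.exp (-(r * ‖x‖))) := by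
          refine mul_le_mul hb (ha.trans ?_) (abs_nonneg _) (by positivity)
          exact mul_le_mul_of_nonneg_right (hdiff x) (Real.exp_nonneg _)
      _ = _ := by ring
  have hκ := unitBallVolume_pos d
  have hfac : (0 : ℝ) < (d + 1).factorial := by positivity
  have hsum : (unitBallVolume d * (d + 1).factorial) * (δ * (δ * (2 / W) ^ (d + 2))) ≤
      (unitBallVolume d * (d + 1).factorial) * (δ * (η * d * (1 / r) ^ (d + 2))) := by linarith
  have hsum' := le_of_mul_le_mul_left hsum (by positivity)
  have hδ : 0 ≤ δ := norm_nonneg _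
  rcases hδ.eq_or_lt with h0 | h0
  · rw [← h0]; positivity
  · have h3 := le_of_mul_le_mul_left hsum' h0
    have h4 : η * d * (W / (2 * r)) ^ (d + 2) = η * d * (1 / r) ^ (d + 2) * (W / 2) ^ (d + 2) := by
      rw [mul_assoc _ ((1 / r) ^ _), ← mul_pow]; congr 2; field_simp
    have h5 : δ = δ * (2 / W) ^ (d + 2) * (W / 2) ^ (d + 2) := by
      rw [mul_assoc, ← mul_pow, div_mul_div_cancel₀ hW.ne', div_self two_ne_zero, one_pow, mul_one]
    rw [h4, h5]
    gcongr

theorem IsSolidConvexBody.volume_real_pos {K : Set (EuclideanSpace ℝ (Fin d))}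
    (hK : IsSolidConvexBody K) : 0 < volume.real K :=
  ENNReal.toReal_pos (Measure.measure_pos_of_nonempty_interior volume hK.interior_nonempty).ne'
    hK.isCompact.measure_lt_top.ne

theorem IsSolidConvexBody.diam_pos (hd : d ≠ 0) {K : Set (EuclideanSpace ℝ (Fin d))}
    (hK : IsSolidConvexBody K) : 0 < Metric.diam K := by
  have : Nonempty (Fin d) := Fin.pos_iff_nonempty.1 (Nat.pos_of_ne_zero hd)
  obtain ⟨z, hz⟩ := hK.interior_nonempty
  obtain ⟨r, hr, h⟩ := exists_le_supportFn_of_mem_interior hK.isCompact hz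
  obtain ⟨u, hu⟩ := exists_ne (0 : EuclideanSpace ℝ (Fin d))
  have h1 := h u
  have h2 := h (-u)
  have h3 := supportFn_add_supportFn_neg_le hK.isCompact ⟨z, interior_subset hz⟩ u
  rw [inner_neg_right, norm_neg] at h2
  have hu' := norm_pos_iff.2 hu
  have : 0 < r * ‖u‖ := by positivity
  exact pos_of_mul_pos_left (by linarith) hu'.le

theorem IsSantaloPoint.inradius_le (hd : 2 ≤ d) {K : Set (EuclideanSpace ℝ (Fin d))}
    (hK : IsSolidConvexBody K) {s : EuclideanSpace ℝ (Fin d)} (hs : IsSantaloPoint K s)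
    (x : EuclideanSpace ℝ (Fin d)) :
    volume.real K / ((d + 1) * ((Metric.diam K / √2) ^ (d - 1) * unitBallVolume (d - 1))) * ‖x‖ ≤
      supportFn K x - inner ℝ s x := by
  have hne : K.Nonempty := ⟨s, interior_subset hs.1⟩
  have hd0 : d ≠ 0 := by omega
  have hD := hK.diam_pos hd0
  have hκ := unitBallVolume_pos (d - 1)
  rcases eq_or_ne x 0 with rfl | hx
  · simp [supportFn_zero hne]
  have hx' : 0 < ‖x‖ := norm_pos_iff.2 hx
  have hu : ‖‖x‖⁻¹ • x‖ = 1 := by rw [norm_smul, norm_inv, norm_norm, inv_mul_cancel₀ hx'.ne']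
  have h1 := volume_real_le_width_mul hd hK.isCompact hne hu
  rw [← smul_neg, supportFn_smul hK.isCompact hne (by positivity),
    supportFn_smul hK.isCompact hne (by positivity), ← mul_add] at h1
  have h2 := hs.width_le hd0 hK x
  rw [div_mul_eq_mul_div, div_le_iff₀ (by positivity)]
  calc volume.real K * ‖x‖ ≤ ‖x‖⁻¹ * (supportFn K x + supportFn K (-x)) *
        ((Metric.diam K / √2) ^ (d - 1) * unitBallVolume (d - 1)) * ‖x‖ := by gcongr
    _ = (supportFn K x + supportFn K (-x)) *
        ((Metric.diam K / √2) ^ (d - 1) * unitBallVolume (d - 1)) := by field_simp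
    _ ≤ (d + 1) * (supportFn K x - inner ℝ s x) *
        ((Metric.diam K / √2) ^ (d - 1) * unitBallVolume (d - 1)) := by gcongr
    _ = _ := by ring

end Stability

section Sandwich

variable {d : ℕ} {K K₀ : Set (EuclideanSpace ℝ (Fin d))}

theorem le_supportFn_of_smul_add_subset (hK : IsCompact K) (hK₀ : IsCompact K₀)
    (hne : K₀.Nonempty) {t : ℝ} {a : EuclideanSpace ℝ (Fin d)} (h : t • K₀ + {a} ⊆ K)
    (x : EuclideanSpace ℝ (Fin d)) : t * supportFn K₀ x + inner ℝ a x ≤ supportFn K x := by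
  obtain ⟨y, hy, hyx⟩ := exists_inner_eq_supportFn hK₀ hne x
  have := inner_le_supportFn hK x (h (add_mem_add (smul_mem_smul_set hy) rfl))
  rw [inner_add_right, real_inner_smul_right, hyx, real_inner_comm] at this
  exact this

theorem supportFn_le_of_subset_smul_add (hne : K.Nonempty) (hK₀ : IsCompact K₀)
    {t : ℝ} {b : EuclideanSpace ℝ (Fin d)} (h : K ⊆ t • K₀ + {b}) (ht : 0 ≤ t)
    (x : EuclideanSpace ℝ (Fin d)) : supportFn K x ≤ t * supportFn K₀ x + inner ℝ b x := by
  refine supportFn_le hne fun y hy => ?_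
  obtain ⟨_, ⟨p, hp, rfl⟩, _, rfl, rfl⟩ := h hy
  simp only
  rw [inner_add_right, real_inner_smul_right, real_inner_comm x]
  gcongr
  exact inner_le_supportFn hK₀ x hp

theorem abs_supportFn_sub_le (hK : IsCompact K) (hne : K.Nonempty) (hK₀ : IsCompact K₀)
    (hne₀ : K₀.Nonempty) {ε : ℝ} (hε : 0 ≤ ε) {a b : EuclideanSpace ℝ (Fin d)}
    (hKl : (1 - ε) • K₀ + {a} ⊆ K) (hKu : K ⊆ (1 + ε) • K₀ + {b})
    (x : EuclideanSpace ℝ (Fin d)) :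
    |supportFn K x - supportFn K₀ x - inner ℝ ((1 / 2 : ℝ) • (a + b)) x| ≤
      ε * Metric.diam K₀ * ‖x‖ := by
  have hl := le_supportFn_of_smul_add_subset hK hK₀ hne₀ hKl
  have hu := supportFn_le_of_subset_smul_add hne hK₀ hKu (by linarith)
  have h1 := hl x
  have h2 := hu x
  have h3 := (hl (-x)).trans (hu (-x))
  have h4 := mul_le_mul_of_nonneg_left (supportFn_add_supportFn_neg_le hK₀ hne₀ x) hε
  rw [inner_neg_right, inner_neg_right] at h3
  rw [real_inner_smul_left, inner_add_left, abs_le]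
  constructor <;> linarith

theorem pow_mul_volume_real_le (hK : IsCompact K) {t : ℝ} (ht : 0 ≤ t)
    {a : EuclideanSpace ℝ (Fin d)} (h : t • K₀ + {a} ⊆ K) :
    t ^ d * volume.real K₀ ≤ volume.real K := by
  have := measureReal_mono (μ := volume) h hK.measure_lt_top.ne
  rwa [add_singleton, image_add_right, Measure.real, measure_preimage_add_right,
    Measure.addHaar_smul, finrank_euclideanSpace_fin, ENNReal.toReal_mul,
    ENNReal.toReal_ofReal (abs_nonneg _), abs_of_nonneg (by positivity)] at this

theorem mul_succ_le_two_pow {d : ℕ} (hd : 2 ≤ d) : (5 * (d * (d + 1)) : ℝ) ≤ 2 ^ (2 * d + 1) := by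
  induction d, hd using Nat.le_induction with
  | base => norm_num
  | succ n hn ih =>
    have hn' : (2 : ℝ) ≤ n := by exact_mod_cast hn
    rw [show 2 * (n + 1) + 1 = 2 * n + 1 + 2 by ring, pow_add]
    push_cast
    nlinarith

/-- For `ε` below the threshold, the perturbation of the support function is at most a
twentieth of the lower bound for the distance of the Santaló point from the boundary. -/
theorem mul_diam_le_of_le_epsOneBound (hd : 2 ≤ d) (hK₀ : IsSolidConvexBody K₀) {ε : ℝ}
    (hε : ε ≤ epsOneBound K₀) :
    ε * Metric.diam K₀ ≤ 1 / 20 * (volume.real K₀ /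
      ((d + 1) * ((Metric.diam K₀ / √2) ^ (d - 1) * unitBallVolume (d - 1)))) := by
  obtain ⟨n, rfl⟩ : ∃ n, d = n + 1 := ⟨d - 1, by omega⟩
  have hb := hε.trans (min_le_right _ _)
  rw [Nat.add_sub_cancel] at *
  have hD := hK₀.diam_pos (by omega)
  have hV := hK₀.volume_real_pos
  set D := Metric.diam K₀
  set V := volume.real K₀
  have hκ := unitBallVolume_pos n
  have hκ' := unitBallVolume_pos (n + 1)
  have hle := unitBallVolume_le_succ n
  have h2 := mul_succ_le_two_pow hd
  push_cast at *
  set κ := unitBallVolume n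
  set κ' := unitBallVolume (n + 1)
  set T : ℝ := 2 ^ (2 * (n + 1) + 1)
  have hT : 0 < T := by positivity
  have hs : 1 ≤ √2 ^ n := one_le_pow₀ (Real.one_le_sqrt.2 one_le_two)
  have hsq : (2 * κ) ^ 2 ≤ ((n + 1) * κ') ^ 2 := pow_le_pow_left₀ (by positivity) hle 2
  calc ε * D ≤ (T⁻¹ * (κ / ((n + 1) * κ' ^ 2)) * V / D ^ (n + 1)) * D := by gcongr
    _ = V / D ^ n * (κ / (T * ((n + 1) * κ' ^ 2))) := by rw [pow_succ D]; field_simp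
    _ ≤ V / D ^ n * (√2 ^ n / (20 * ((n + 1 + 1) * κ))) := by
      gcongr ?_ * ?_
      rw [div_le_div_iff₀ (by positivity) (by positivity)]
      calc κ * (20 * ((n + 1 + 1) * κ)) = (2 * κ) ^ 2 * (5 * (n + 2)) := by ring
        _ ≤ ((n + 1) * κ') ^ 2 * (5 * (n + 2)) := by gcongr
        _ = (5 * ((n + 1) * (n + 1 + 1))) * ((n + 1) * κ' ^ 2) := by ring
        _ ≤ T * ((n + 1) * κ' ^ 2) := by gcongr
        _ ≤ √2 ^ n * (T * ((n + 1) * κ' ^ 2)) := le_mul_of_one_le_left (by positivity) hs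
    _ = _ := by rw [div_pow]; field_simp

theorem stability_const_le (hd : 2 ≤ d) (hK₀ : IsSolidConvexBody K₀) {ε W r : ℝ} (hε : 0 ≤ ε)
    (hW0 : 0 ≤ W) (hr : 0 < r)
    (hW : W * r⁻¹ ≤ 6 / 5 * (Metric.diam K₀ / (volume.real K₀ /
      ((d + 1) * ((Metric.diam K₀ / √2) ^ (d - 1) * unitBallVolume (d - 1)))))) :
    ε * Metric.diam K₀ * d * (W / (2 * r)) ^ (d + 2) ≤ centreConstOne K₀ * ε := by
  obtain ⟨n, rfl⟩ : ∃ n, d = n + 2 := ⟨d - 2, by omega⟩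
  have hD := hK₀.diam_pos (by omega)
  have hV := hK₀.volume_real_pos
  have hκ := unitBallVolume_pos (n + 1)
  have hκ' := unitBallVolume_pos (n + 2)
  have hle := unitBallVolume_sq_le n
  rw [centreConstOne]
  rw [show n + 2 - 1 = n + 1 by omega] at *
  set D := Metric.diam K₀
  set V := volume.real K₀
  push_cast at *
  set κ := unitBallVolume (n + 1)
  set κ' := unitBallVolume (n + 2)
  have hq : W / (2 * r) ≤ D ^ (n + 2) * V⁻¹ * ((n + 2) * κ' / κ) := by
    have hs2 : √2 ^ 2 = 2 := Real.sq_sqrt zero_le_two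
    calc W / (2 * r) = W * r⁻¹ / 2 := by field_simp
      _ ≤ 6 / 5 * (D / (V / ((n + 2 + 1) * ((D / √2) ^ (n + 1) * κ)))) / 2 := by gcongr
      _ = D ^ (n + 2) * V⁻¹ * (6 / 5 * ((n + 3) * κ ^ 2) / (√2 ^ (n + 1) * 2 * κ)) := by
        rw [div_pow]; field_simp; ring
      _ ≤ D ^ (n + 2) * V⁻¹ * (√2 ^ (n + 3) * ((n + 2) * κ') / (√2 ^ (n + 1) * 2 * κ)) := by
        gcongr
      _ = _ := by
        rw [show n + 3 = n + 1 + 2 by ring, pow_add √2, hs2]; field_simp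
  calc ε * D * (n + 2) * (W / (2 * r)) ^ (n + 2 + 2)
      ≤ ε * D * (n + 2) * (D ^ (n + 2) * V⁻¹ * ((n + 2) * κ' / κ)) ^ (n + 2 + 2) := by
        gcongr
    _ = _ := by
      rw [mul_pow, mul_pow, ← pow_mul, inv_pow, show (n + 2 + 1) ^ 2 = (n + 2) * (n + 2 + 2) + 1 by ring,
        pow_succ D]
      ring

end Sandwich

theorem mainTheorem9 (d : ℕ) (hd : 2 ≤ d)
    (K₀ : Set (EuclideanSpace ℝ (Fin d))) (hK₀ : IsSolidConvexBody K₀)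
    (ε₁ : ℝ) (hε₁ : 0 < ε₁) (hε₁' : ε₁ ≤ epsOneBound K₀)
    (K : Set (EuclideanSpace ℝ (Fin d))) (hK : IsSolidConvexBody K)
    (a b : EuclideanSpace ℝ (Fin d))
    (hKl : (1 - ε₁) • K₀ + {a} ⊆ K) (hKu : K ⊆ (1 + ε₁) • K₀ + {b}) :
    ‖santaloPoint K - santaloPoint K₀ - (1 / 2 : ℝ) • (a + b)‖ ≤ centreConstOne K₀ * ε₁ ∧
    ∀ (ε₂ : ℝ) (c : EuclideanSpace ℝ (Fin d)), 0 < ε₂ → c ∈ interior K →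
      volumeProductAt K₀ (santaloPoint K₀) ≤ volumeProductAt K (santaloPoint K) →
      volumeProductAt K c ≤ volumeProductAt K₀ (santaloPoint K₀) + ε₂ →
      volumeProductAt K₀ (santaloPoint K₀) + ε₂ ≤ unitBallVolume d ^ 2 →
      ‖c - santaloPoint K₀ - (1 / 2 : ℝ) • (a + b)‖ ≤
        centreConstOne K₀ * ε₁ + centreConstTwo K₀ * Real.sqrt ε₂ := by
  have hd0 : d ≠ 0 := by omega
  have hS := isSantaloPoint_santaloPoint hd0 hK
  have hS₀ := isSantaloPoint_santaloPoint hd0 hK₀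
  set s := santaloPoint K
  set s₀ := santaloPoint K₀
  set m := (1 / 2 : ℝ) • (a + b)
  have hne : K.Nonempty := ⟨s, interior_subset hS.1⟩
  have hne₀ : K₀.Nonempty := ⟨s₀, interior_subset hS₀.1⟩
  have hc := continuous_supportFn hK.isCompact hne
  have hc₀ := continuous_supportFn hK₀.isCompact hne₀
  have hhalf : ε₁ ≤ 1 / 2 := hε₁'.trans (min_le_left _ _)
  have hD := hK₀.diam_pos hd0
  have hV := hK₀.volume_real_pos
  have hsym : ∀ x, supportFn K x + supportFn K (-x) ≤ (1 + ε₁) * Metric.diam K₀ * ‖x‖ := by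
    intro x
    have h1 := supportFn_le_of_subset_smul_add hne hK₀.isCompact hKu (by linarith)
    have h2 := supportFn_add_supportFn_neg_le hK₀.isCompact hne₀ x
    have h3 := h1 x
    have h4 := h1 (-x)
    rw [inner_neg_right] at h4
    nlinarith
  obtain ⟨r', hr', hr's⟩ := exists_le_supportFn_of_mem_interior hK.isCompact hS.1
  have hfirst : ‖s - s₀ - m‖ ≤ centreConstOne K₀ * ε₁ := by
    have hρ := hS₀.inradius_le hd hK₀
    have hη := mul_diam_le_of_le_epsOneBound hd hK₀ hε₁'
    set ρ := volume.real K₀ /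
      ((d + 1) * ((Metric.diam K₀ / √2) ^ (d - 1) * unitBallVolume (d - 1))) with hρdef
    have hρ0 : 0 < ρ := by
      have := unitBallVolume_pos (d - 1)
      positivity
    have hρD : ρ ≤ Metric.diam K₀ := by
      have : Nonempty (Fin d) := Fin.pos_iff_nonempty.1 (Nat.pos_of_ne_zero hd0)
      obtain ⟨u, hu⟩ := exists_ne (0 : EuclideanSpace ℝ (Fin d))
      have h1 := hρ u
      have h2 := (mul_nonneg hρ0.le (norm_nonneg _)).trans (hρ (-u))
      have h3 := supportFn_add_supportFn_neg_le hK₀.isCompact hne₀ u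
      rw [inner_neg_right] at h2
      exact le_of_mul_le_mul_right (by linarith) (norm_pos_iff.2 hu)
    have hε20 : ε₁ ≤ 1 / 20 := le_of_mul_le_mul_right (hη.trans (by linarith)) hD
    have hdiff := abs_supportFn_sub_le hK.isCompact hne hK₀.isCompact hne₀ hε₁.le
      hKl hKu
    have hdiff' : ∀ x, |(supportFn K x - inner ℝ (s₀ + m) x) -
        (supportFn K₀ x - inner ℝ s₀ x)| ≤ ε₁ * Metric.diam K₀ * ‖x‖ := by
      intro x
      convert hdiff x using 2
      rw [inner_add_left]; ring
    have hr : 0 < 19 / 20 * ρ := by positivity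
    have key := norm_sub_le_of_critical hd0 hc hc₀ (by positivity) hr hr' (by positivity) hsym
      (s := s) (s₀ := s₀) (z := s₀ + m) (η := ε₁ * Metric.diam K₀)
      (fun x => by
        have h1 := (abs_le.1 (hdiff' x)).1
        have h2 := hρ x
        have h3 := mul_le_mul_of_nonneg_right hη (norm_nonneg x)
        linarith) hr's
      (fun x => by
        have h2 := hρ x
        have h3 := mul_nonneg hρ0.le (norm_nonneg x)
        linarith) hdiff' (hS.integral_inner_mul_exp_eq_zero hd0 hK)
      (hS₀.integral_inner_mul_exp_eq_zero hd0 hK₀)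
    rw [sub_sub]
    refine key.trans (stability_const_le hd hK₀ hε₁.le (by positivity) hr ?_)
    rw [← hρdef]
    have : (1 + ε₁) * Metric.diam K₀ * (19 / 20 * ρ)⁻¹ =
        (1 + ε₁) * (20 / 19) * (Metric.diam K₀ / ρ) := by field_simp
    rw [this]
    gcongr
    linarith
  refine ⟨hfirst, fun ε₂ c hε₂ hcK hP hPc _ => ?_⟩
  have htri : ‖c - s₀ - m‖ ≤ ‖s - s₀ - m‖ + ‖c - s‖ := by
    have := norm_add_le (s - s₀ - m) (c - s)
    rwa [show s - s₀ - m + (c - s) = c - s₀ - m by abel] at this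
  refine htri.trans (add_le_add hfirst ?_)
  obtain ⟨r, hr, hrc⟩ := exists_le_supportFn_of_mem_interior hK.isCompact hcK
  have hsym2 : ∀ x, supportFn K x + supportFn K (-x) ≤ 2 * Metric.diam K₀ * ‖x‖ := fun x =>
    (hsym x).trans (by gcongr; linarith)
  have hm : 0 < min r r' := lt_min hr hr'
  have hconv := add_sq_le_integral_exp hd0 hc (by positivity) hm hsym2
    (fun x => (mul_le_mul_of_nonneg_right (min_le_right r r') (norm_nonneg x)).trans (hr's x))
    (fun x => (mul_le_mul_of_nonneg_right (min_le_left r r') (norm_nonneg x)).trans (hrc x))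
  rw [hS.integral_inner_mul_exp_eq_zero hd0 hK, volume_real_convexPolar hK.isCompact
    (interior_subset hS.1), volume_real_convexPolar hK.isCompact (interior_subset hcK)] at hconv
  have hvol := pow_mul_volume_real_le hK.isCompact (by linarith) hKl
  have hVK : volume.real K₀ ≤ 2 ^ d * volume.real K := by
    have h1 : (1 / 2 : ℝ) ^ d ≤ (1 - ε₁) ^ d := pow_le_pow_left₀ (by norm_num) (by linarith) d
    have h2 := (mul_le_mul_of_nonneg_right h1 hV.le).trans hvol
    rw [one_div, inv_pow, inv_mul_le_iff₀ (by positivity)] at h2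
    exact h2
  unfold volumeProductAt at *
  set V := volume.real K₀
  set Vc := volume.real (convexPolar (K - {c}))
  set Vs := volume.real (convexPolar (K - {s}))
  set D := Metric.diam K₀
  have hκ := unitBallVolume_pos d
  have hprod : volume.real K * (Vc - Vs) ≤ ε₂ := by linarith
  rw [centreConstTwo]
  refine abs_le_of_sq_le_sq' ?_ (by positivity) |>.2
  rw [mul_pow, mul_pow, Real.sq_sqrt (by positivity), Real.sq_sqrt (by positivity),
    Real.sq_sqrt hε₂.le]
  have hfac : ((d + 1).factorial : ℝ) = (d + 1) * d.factorial := by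
    rw [Nat.factorial_succ]; push_cast; ring
  have hf0 : (0 : ℝ) < d.factorial := by positivity
  have h3 : ‖c - s‖ ^ 2 * unitBallVolume d * (d + 1) * (1 / D) ^ (d + 2) ≤ 2 * (Vc - Vs) := by
    rw [hfac, show 2 / (2 * D) = 1 / D by field_simp] at hconv
    refine le_of_mul_le_mul_left ?_ hf0
    linarith
  have hVs : 0 ≤ Vc - Vs := by
    have : 0 ≤ ‖c - s‖ ^ 2 * unitBallVolume d * (d + 1) * (1 / D) ^ (d + 2) := by positivity
    linarith
  have h4 : V * (Vc - Vs) ≤ 2 ^ d * ε₂ := by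
    calc V * (Vc - Vs) ≤ 2 ^ d * volume.real K * (Vc - Vs) := by gcongr
      _ = 2 ^ d * (volume.real K * (Vc - Vs)) := by ring
      _ ≤ _ := by gcongr
  have h5 : ‖c - s‖ ^ 2 * (unitBallVolume d * (d + 1) * V) ≤ 2 * (2 ^ d * ε₂) * D ^ (d + 2) := by
    have : ‖c - s‖ ^ 2 * (unitBallVolume d * (d + 1) * V) =
        V * (‖c - s‖ ^ 2 * unitBallVolume d * (d + 1) * (1 / D) ^ (d + 2)) * D ^ (d + 2) := by
      rw [one_div, inv_pow]; field_simp
    rw [this]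
    refine mul_le_mul_of_nonneg_right ?_ (by positivity)
    calc _ ≤ V * (2 * (Vc - Vs)) := by gcongr
      _ = 2 * (V * (Vc - Vs)) := by ring
      _ ≤ _ := by gcongr
  calc ‖c - s‖ ^ 2 ≤ 2 * (2 ^ d * ε₂) * D ^ (d + 2) / (unitBallVolume d * (d + 1) * V) :=
        (le_div_iff₀ (by positivity)).2 h5
    _ = D ^ (d + 2) / V * (2 ^ (d + 1) / ((d + 1) * unitBallVolume d)) * ε₂ := by
        rw [pow_succ 2]; field_simp
    _ ≤ _ := by
        gcongr
        · norm_num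
        · norm_num

end
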